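/- Let ZFG[$0$] be the first-order theory in the language with equality, membership $\in$ and one further binary relation symbol $\leq_\gamma$ whose axioms are extensionality, foundation, pairing, union, infinity, the replacement scheme (which includes separation) for all formulas of this language with parameters, and axioms saying that $\leq_\gamma$ is a linear order of the universe such that every non-empty class definable by a formula of this language with parameters has a $\leq_\gamma$-minimal element. (So ZFG[$0$] is Zermelo–Fraenkel set theory without the power set axiom, together with a global well-ordering.) Then ZFG[$0$] proves: for every commutative ring $R$ with unit and every family $(M_i)_{i\in I}$ of $R$-modules indexed by a set $I$, the coproduct (direct sum) $\coprod_{i\in I}M_i$ exists, that is, there are an $R$-module $C$ and a family of $R$-linear maps $j_i\colon M_i\to C$ such that for every $R$-module $N$ and every family of $R$-linear maps $g_i\colon M_i\to N$ there is exactly one $R$-linear map $h\colon C\to N$ with $h\circ j_i=g_i$ for all $i\in I$. Moreover, $C$ can be taken to be a quotient, by an equivalence relation, of the set of all finite subsets of $R\times\bigsqcup_{i\in I}M_i$, where $\bigsqcup_{i\in I}M_i=\{\langle i,y\rangle : i\in I,\ y\in M_i\}$ is the disjoint union, in such a way that the class of a finite subset $s$ is the sum $\sum_{\langle r,\langle i,y\rangle\rangle\in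 s} r\cdot j_i(y)$ in $C$. -/

import Mathlib

open scoped FirstOrder

namespace ZFG

/-! ## The language of set theory with a global well-ordering -/

/-- The two binary relation symbols: membership and the global well-ordering. -/
inductive Rel : ℕ → Type
  | mem : Rel 2
  | le : Rel 2

/-- The first-order language with `∈` and `≤_γ` (and equality). -/
def lang : FirstOrder.Language.{0, 0} := ⟨fun _ => Empty, Rel⟩

/-! ## Writing formulas

A template `Fm` is a formula with variables named by natural numbers, which is told the first
name `k` that is still unused; a quantifier binds the name `k` and passes on `k + 1`. -/

/-- Formula templates. -/
abbrev Fm := ℕ → lang.Formula ℕ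

/-- Universal quantification over the variable named `k`. -/
def bindAll (k : ℕ) (φ : lang.Formula ℕ) : lang.Formula ℕ :=
  (FirstOrder.Language.BoundedFormula.relabel
    (fun i : ℕ => if i = k then (Sum.inr 0 : ℕ ⊕ Fin 1) else Sum.inl i) φ).all

namespace Fm

def mem (x y : ℕ) : Fm := fun _ =>
  FirstOrder.Language.Relations.formula₂ (L := lang) Rel.mem (FirstOrder.Language.Term.var x) (FirstOrder.Language.Term.var y)
def le (x y : ℕ) : Fm := fun _ =>
  FirstOrder.Language.Relations.formula₂ (L := lang) Rel.le (FirstOrder.Language.Term.var x) (FirstOrder.Language.Term.var y)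
def eq (x y : ℕ) : Fm := fun _ =>
  FirstOrder.Language.Term.equal (L := lang) (FirstOrder.Language.Term.var x) (FirstOrder.Language.Term.var y)
def neg (φ : Fm) : Fm := fun k => (φ k).not
def imp (φ ψ : Fm) : Fm := fun k => FirstOrder.Language.BoundedFormula.imp (φ k) (ψ k)
def and (φ ψ : Fm) : Fm := fun k => φ k ⊓ ψ k
def or (φ ψ : Fm) : Fm := fun k => φ k ⊔ ψ k
def iff (φ ψ : Fm) : Fm := fun k => FirstOrder.Language.BoundedFormula.iff (φ k) (ψ k)
def all (f : ℕ → Fm) : Fm := fun k => bindAll k (f k (k + 1))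
def ex (f : ℕ → Fm) : Fm := neg (all fun x => neg (f x))

infix:60 " ∈ᶠ " => mem
infix:60 " ≤ᶠ " => le
infix:60 " =ᶠ " => eq
infixr:45 " ∧ᶠ " => and
infixr:40 " ∨ᶠ " => or
infixr:35 " →ᶠ " => imp
infix:30 " ↔ᶠ " => iff

/-- `∀ x ∈ A, φ x` -/
def allIn (A : ℕ) (f : ℕ → Fm) : Fm := all fun x => x ∈ᶠ A →ᶠ f x
/-- `∃ x ∈ A, φ x` -/
def exIn (A : ℕ) (f : ℕ → Fm) : Fm := ex fun x => x ∈ᶠ A ∧ᶠ f x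

/-- The sentence `∀ x₀ … xₙ, φ`, where `φ` has at most the variables named `0, …, n` free. -/
def closure (n : ℕ) (φ : Fm) : lang.Sentence :=
  (FirstOrder.Language.BoundedFormula.relabel (fun i : ℕ => (Sum.inr (Fin.ofNat (n + 1) i) :
    Empty ⊕ Fin (n + 1))) (φ (n + 1)) : lang.BoundedFormula Empty (n + 1)).alls

/-- An arbitrary formula with parameters `p 0, …, p n` and two further variables. -/
def inst₂ {n : ℕ} (φ : lang.Formula (Fin (n + 1) ⊕ Fin 2)) (x y : ℕ) : Fm := fun _ =>
  φ.relabel (Sum.elim (fun i : Fin (n + 1) => (i : ℕ)) ![x, y])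
/-- An arbitrary formula with parameters `p 0, …, p n` and one further variable. -/
def inst₁ {n : ℕ} (φ : lang.Formula (Fin (n + 1) ⊕ Fin 1)) (x : ℕ) : Fm := fun _ =>
  φ.relabel (Sum.elim (fun i : Fin (n + 1) => (i : ℕ)) ![x])

end Fm

/-! ## Satisfaction of templates in a structure -/

section Realize

universe u
variable {M : Type u} [lang.Structure M]

/-- Membership in a structure. -/
def Mem (x y : M) : Prop := FirstOrder.Language.Structure.RelMap (L := lang) Rel.mem ![x, y]
/-- The well-ordering in a structure. -/
def Le (x y : M) : Prop := FirstOrder.Language.Structure.RelMap (L := lang) Rel.le ![x, y]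

variable {k : ℕ} {v : ℕ → M}

@[simp] theorem realize_mem {x y : ℕ} : (Fm.mem x y k).Realize v ↔ Mem (v x) (v y) := by
  exact FirstOrder.Language.Formula.realize_rel₂
@[simp] theorem realize_le {x y : ℕ} : (Fm.le x y k).Realize v ↔ Le (v x) (v y) := by
  exact FirstOrder.Language.Formula.realize_rel₂
@[simp] theorem realize_eq {x y : ℕ} : (Fm.eq x y k).Realize v ↔ v x = v y := by
  simp [Fm.eq]
@[simp] theorem realize_neg {φ : Fm} : (Fm.neg φ k).Realize v ↔ ¬ (φ k).Realize v := by
  simp [Fm.neg]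
@[simp] theorem realize_imp {φ ψ : Fm} :
    (Fm.imp φ ψ k).Realize v ↔ ((φ k).Realize v → (ψ k).Realize v) := by
  simp [Fm.imp]
@[simp] theorem realize_and {φ ψ : Fm} :
    (Fm.and φ ψ k).Realize v ↔ ((φ k).Realize v ∧ (ψ k).Realize v) := by
  simp [Fm.and]
@[simp] theorem realize_or {φ ψ : Fm} :
    (Fm.or φ ψ k).Realize v ↔ ((φ k).Realize v ∨ (ψ k).Realize v) := by
  simp [Fm.or]
@[simp] theorem realize_iff {φ ψ : Fm} :
    (Fm.iff φ ψ k).Realize v ↔ ((φ k).Realize v ↔ (ψ k).Realize v) := by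
  simp [Fm.iff]
@[simp] theorem realize_all {f : ℕ → Fm} :
    (Fm.all f k).Realize v ↔ ∀ x, (f k (k + 1)).Realize (Function.update v k x) := by
  unfold Fm.all bindAll FirstOrder.Language.Formula.Realize
  rw [FirstOrder.Language.BoundedFormula.realize_all]
  refine forall_congr' fun x => ?_
  erw [FirstOrder.Language.BoundedFormula.realize_relabel]
  refine iff_of_eq ?_
  congr 1
  · funext i
    by_cases h : i = k
    · subst h; simp [Fin.snoc]
    · simp [h]
  · exact Subsingleton.elim _ _
@[simp] theorem realize_ex {f : ℕ → Fm} :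
    (Fm.ex f k).Realize v ↔ ∃ x, (f k (k + 1)).Realize (Function.update v k x) := by
  simp [Fm.ex]
@[simp] theorem realize_allIn {A : ℕ} {f : ℕ → Fm} (hA : A < k) : (Fm.allIn A f k).Realize v ↔
    ∀ x, Mem x (v A) → (f k (k + 1)).Realize (Function.update v k x) := by
  simp [Fm.allIn, Function.update_of_ne hA.ne]
@[simp] theorem realize_exIn {A : ℕ} {f : ℕ → Fm} (hA : A < k) : (Fm.exIn A f k).Realize v ↔
    ∃ x, Mem x (v A) ∧ (f k (k + 1)).Realize (Function.update v k x) := by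
  simp [Fm.exIn, Function.update_of_ne hA.ne]

theorem realize_closure {n : ℕ} {φ : Fm} : M ⊨ Fm.closure n φ ↔
    ∀ p : Fin (n + 1) → M, (φ (n + 1)).Realize fun i => p (Fin.ofNat (n + 1) i) := by
  unfold Fm.closure FirstOrder.Language.Sentence.Realize FirstOrder.Language.Formula.Realize
  refine FirstOrder.Language.BoundedFormula.realize_alls.trans ?_
  refine forall_congr' fun p => ?_
  erw [FirstOrder.Language.BoundedFormula.realize_relabel]
  exact iff_of_eq (by congr 1; exact Subsingleton.elim _ _)

theorem realize_inst₂ {n : ℕ} {φ : lang.Formula (Fin (n + 1) ⊕ Fin 2)} {x y : ℕ} :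
    (Fm.inst₂ φ x y k).Realize v ↔
      φ.Realize (Sum.elim (fun i : Fin (n + 1) => v i) ![v x, v y]) := by
  unfold Fm.inst₂
  rw [FirstOrder.Language.Formula.realize_relabel]
  refine iff_of_eq (congrArg _ ?_)
  funext i
  rcases i with i | i
  · rfl
  · fin_cases i <;> rfl
theorem realize_inst₁ {n : ℕ} {φ : lang.Formula (Fin (n + 1) ⊕ Fin 1)} {x : ℕ} :
    (Fm.inst₁ φ x k).Realize v ↔
      φ.Realize (Sum.elim (fun i : Fin (n + 1) => v i) ![v x]) := by
  unfold Fm.inst₁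
  rw [FirstOrder.Language.Formula.realize_relabel]
  refine iff_of_eq (congrArg _ ?_)
  funext i
  rcases i with i | i
  · rfl
  · fin_cases i; rfl

end Realize

/-! ## The theory ZFG[0] -/

namespace Fm

def extensionality : Fm := all fun a => all fun b => (all fun x => x ∈ᶠ a ↔ᶠ x ∈ᶠ b) →ᶠ a =ᶠ b
def foundation : Fm :=
  all fun a => (ex fun x => x ∈ᶠ a) →ᶠ exIn a fun x => allIn a fun y => neg (y ∈ᶠ x)
def pairing : Fm := all fun a => all fun b => ex fun c => all fun x => x ∈ᶠ c ↔ᶠ x =ᶠ a ∨ᶠ x =ᶠ b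
def union : Fm := all fun a => ex fun u => all fun x => x ∈ᶠ u ↔ᶠ exIn a fun y => x ∈ᶠ y
def infinity : Fm := ex fun w => (exIn w fun e => all fun z => neg (z ∈ᶠ e)) ∧ᶠ
  allIn w fun x => exIn w fun y => all fun z => z ∈ᶠ y ↔ᶠ z ∈ᶠ x ∨ᶠ z =ᶠ x
/-- Replacement for the class relation defined by `φ`, which may mention `≤_γ` and parameters, and
need only be a partial function on `a` (so that separation is included). -/
def replacement {n : ℕ} (φ : lang.Formula (Fin (n + 1) ⊕ Fin 2)) : Fm := all fun a =>
  (allIn a fun x => all fun y => all fun z => inst₂ φ x y →ᶠ inst₂ φ x z →ᶠ y =ᶠ z) →ᶠ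
  ex fun b => all fun y => y ∈ᶠ b ↔ᶠ exIn a fun x => inst₂ φ x y
def leAntisymm : Fm := all fun x => all fun y => x ≤ᶠ y →ᶠ y ≤ᶠ x →ᶠ x =ᶠ y
def leTrans : Fm := all fun x => all fun y => all fun z => x ≤ᶠ y →ᶠ y ≤ᶠ z →ᶠ x ≤ᶠ z
def leTotal : Fm := all fun x => all fun y => x ≤ᶠ y ∨ᶠ y ≤ᶠ x
/-- If the class defined by `φ` is non-empty, it has a `≤_γ`-minimal element. -/
def leMinimal {n : ℕ} (φ : lang.Formula (Fin (n + 1) ⊕ Fin 1)) : Fm :=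
  (ex fun x => inst₁ φ x) →ᶠ ex fun x => inst₁ φ x ∧ᶠ all fun y => inst₁ φ y →ᶠ x ≤ᶠ y

end Fm

/-- The theory ZFG[0]: Zermelo–Fraenkel set theory without power set, together with a global
well-ordering that may occur in the replacement scheme. -/
inductive IsZFGLaw : lang.Sentence → Prop
  | extensionality : IsZFGLaw (Fm.closure 0 Fm.extensionality)
  | foundation : IsZFGLaw (Fm.closure 0 Fm.foundation)
  | pairing : IsZFGLaw (Fm.closure 0 Fm.pairing)
  | union : IsZFGLaw (Fm.closure 0 Fm.union)
  | infinity : IsZFGLaw (Fm.closure 0 Fm.infinity)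
  | replacement (n : ℕ) (φ : lang.Formula (Fin (n + 1) ⊕ Fin 2)) :
      IsZFGLaw (Fm.closure n (Fm.replacement φ))
  | leAntisymm : IsZFGLaw (Fm.closure 0 Fm.leAntisymm)
  | leTrans : IsZFGLaw (Fm.closure 0 Fm.leTrans)
  | leTotal : IsZFGLaw (Fm.closure 0 Fm.leTotal)
  | leMinimal (n : ℕ) (φ : lang.Formula (Fin (n + 1) ⊕ Fin 1)) :
      IsZFGLaw (Fm.closure n (Fm.leMinimal φ))

/-- The theory ZFG[0] as a set of sentences. -/
def zfg₀ : lang.Theory := {σ | IsZFGLaw σ}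

/-! ## Rings, modules and coproducts in the language of set theory -/

namespace Fm

/-- `c = {a, b}`. -/
def upair (c a b : ℕ) : Fm :=
  all fun z => z ∈ᶠ c ↔ᶠ z =ᶠ a ∨ᶠ z =ᶠ b

/-- `p = ⟨a, b⟩ = {{a}, {a, b}}`. -/
def opair (p a b : ℕ) : Fm :=
  ex fun s => ex fun d => upair s a a ∧ᶠ upair d a b ∧ᶠ upair p s d

/-- `t = ⟨a, ⟨b, c⟩⟩`. -/
def triple (t a b c : ℕ) : Fm :=
  ex fun q => opair q b c ∧ᶠ opair t a q

/-- `P = A × B`. -/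
def product (P A B : ℕ) : Fm :=
  all fun p => p ∈ᶠ P ↔ᶠ exIn A fun x => exIn B fun y => opair p x y

/-- `⟨x, y⟩ ∈ f`, that is `f x = y` if `f` is a function. -/
def app (f x y : ℕ) : Fm :=
  exIn f fun p => opair p x y

/-- `f` is a function from `A` to `B` (a set of ordered pairs). -/
def func (f A B : ℕ) : Fm :=
  (allIn f fun p => exIn A fun x => exIn B fun y => opair p x y) ∧ᶠ
  allIn A fun x => ex fun y => all fun y' => app f x y' ↔ᶠ y' =ᶠ y

/-- `f ⟨x, y⟩ = z`. -/
def app2 (f x y z : ℕ) : Fm :=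
  ex fun p => opair p x y ∧ᶠ app f p z

/-- `f` is a function from `A × B` to `C`. -/
def op (f A B C : ℕ) : Fm :=
  ex fun P => product P A B ∧ᶠ func f P C

/-- `e ∈ A` and `f ⟨e, x⟩ = x` for all `x ∈ A`. -/
def leftUnit (A f e : ℕ) : Fm :=
  e ∈ᶠ A ∧ᶠ allIn A fun x => app2 f e x x

/-- The binary operation `f` on `A` is associative. -/
def assoc (A f : ℕ) : Fm :=
  allIn A fun x => allIn A fun y => allIn A fun z => all fun u => all fun w => all fun t =>
  app2 f x y u →ᶠ app2 f y z w →ᶠ app2 f u z t →ᶠ app2 f x w t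

/-- The binary operation `f` on `A` is commutative. -/
def comm (A f : ℕ) : Fm :=
  allIn A fun x => allIn A fun y => all fun u => app2 f x y u →ᶠ app2 f y x u

/-- `(A, f)` is an abelian group. -/
def abGroup (A f : ℕ) : Fm :=
  op f A A A ∧ᶠ assoc A f ∧ᶠ comm A f ∧ᶠ
  ex fun o => leftUnit A f o ∧ᶠ allIn A fun x => exIn A fun y => app2 f x y o

/-- `R` is a commutative ring with unit, with addition `a` and multiplication `m`. -/
def commRing (R a m : ℕ) : Fm :=
  abGroup R a ∧ᶠ op m R R R ∧ᶠ assoc R m ∧ᶠ comm R m ∧ᶠ (ex fun e => leftUnit R m e) ∧ᶠ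
  allIn R fun x => allIn R fun y => allIn R fun z =>
  all fun s => all fun u => all fun w => all fun t =>
  app2 a y z s →ᶠ app2 m x y u →ᶠ app2 m x z w →ᶠ app2 a u w t →ᶠ app2 m x s t

/-- `N` is a module over the ring `(R, a, m)`, with addition `b` and scalar multiplication
`s : R × N → N`. The last four clauses: `r (x + y) = r x + r y`, `(q + r) x = q x + r x`,
`(q r) x = q (r x)`, and `1 x = x`. -/
def module (R a m N b s : ℕ) : Fm :=
  abGroup N b ∧ᶠ op s R N N ∧ᶠ
  (allIn R fun r => allIn N fun x => allIn N fun y =>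
    all fun z => all fun u => all fun w => all fun t =>
    app2 b x y z →ᶠ app2 s r x u →ᶠ app2 s r y w →ᶠ app2 b u w t →ᶠ app2 s r z t) ∧ᶠ
  (allIn R fun q => allIn R fun r => allIn N fun x =>
    all fun z => all fun u => all fun w => all fun t =>
    app2 a q r z →ᶠ app2 s q x u →ᶠ app2 s r x w →ᶠ app2 b u w t →ᶠ app2 s z x t) ∧ᶠ
  (allIn R fun q => allIn R fun r => allIn N fun x =>
    all fun z => all fun w => all fun t =>
    app2 m q r z →ᶠ app2 s r x w →ᶠ app2 s q w t →ᶠ app2 s z x t) ∧ᶠ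
  all fun e => leftUnit R m e →ᶠ allIn N fun x => app2 s e x x

/-- `f` is an `R`-linear map from `(N, b, s)` to `(N', b', s')`. -/
def linear (R N b s N' b' s' f : ℕ) : Fm :=
  func f N N' ∧ᶠ
  (all fun x => all fun y => all fun z => all fun x' => all fun y' => all fun z' =>
    app2 b x y z →ᶠ app f x x' →ᶠ app f y y' →ᶠ app f z z' →ᶠ app2 b' x' y' z') ∧ᶠ
  allIn R fun r => all fun x => all fun z => all fun x' => all fun z' =>
    app2 s r x z →ᶠ app f x x' →ᶠ app f z z' →ᶠ app2 s' r x' z'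

/-- `F i = ⟨N, ⟨b, s⟩⟩`. -/
def famAt (F i N b s : ℕ) : Fm :=
  ex fun T => app F i T ∧ᶠ triple T N b s

/-- `F` is a function on the set `I` whose value at each `i ∈ I` is an `R`-module
`M_i = ⟨N, ⟨b, s⟩⟩`. -/
def moduleFamily (R a m I F : ℕ) : Fm :=
  (ex fun B => func F I B) ∧ᶠ allIn I fun i => ex fun N => ex fun b => ex fun s =>
  famAt F i N b s ∧ᶠ module R a m N b s

/-- `g` is a function on `I` whose value at each `i ∈ I` is an `R`-linear map from `M_i = F i`
to `(N, b, s)`. -/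
def cocone (R I F N b s g : ℕ) : Fm :=
  (ex fun B => func g I B) ∧ᶠ allIn I fun i => all fun N' => all fun b' => all fun s' =>
  famAt F i N' b' s' →ᶠ ex fun f => app g i f ∧ᶠ linear R N' b' s' N b s f

/-- `h ∘ (g i) = g' i` for all `i ∈ I`. -/
def factors (I g h g' : ℕ) : Fm :=
  allIn I fun i => all fun f => all fun f' => app g i f →ᶠ app g' i f' →ᶠ
  all fun x => all fun y => all fun z => app f x y →ᶠ app h y z →ᶠ app f' x z

/-- The `R`-module `(C, c, t)` with the maps `j i : M_i → C` is a coproduct of the family `F`: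
each family of linear maps `g i : M_i → N` is `h ∘ j i` for exactly one linear `h : C → N`. -/
def coproduct (R a m I F C c t j : ℕ) : Fm :=
  module R a m C c t ∧ᶠ cocone R I F C c t j ∧ᶠ
  all fun N => all fun b => all fun s => all fun g =>
  module R a m N b s →ᶠ cocone R I F N b s g →ᶠ
  ex fun h => all fun h' => (linear R C c t N b s h' ∧ᶠ factors I j h' g) ↔ᶠ h' =ᶠ h

/-- `D` is the disjoint union of the `M_i`: the set of pairs `⟨i, y⟩` with `i ∈ I`, `y ∈ M_i`. -/
def disjointUnion (D I F : ℕ) : Fm :=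
  all fun p => p ∈ᶠ D ↔ᶠ exIn I fun i => ex fun N => ex fun b => ex fun s =>
  famAt F i N b s ∧ᶠ exIn N fun y => opair p i y

/-- `e = ∅`. -/
def empty (e : ℕ) : Fm :=
  all fun z => neg (z ∈ᶠ e)

/-- `u = s ∪ {p}`. -/
def insert (u s p : ℕ) : Fm :=
  all fun z => z ∈ᶠ u ↔ᶠ z ∈ᶠ s ∨ᶠ z =ᶠ p

/-- `∅ ∈ w`, and `x ∪ {x} ∈ w` for all `x ∈ w`. -/
def inductiveSet (w : ℕ) : Fm :=
  (exIn w fun e => empty e) ∧ᶠ allIn w fun x => exIn w fun y => insert y x x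

/-- `n` is a natural number: it belongs to every inductive set. -/
def natural (n : ℕ) : Fm :=
  all fun w => inductiveSet w →ᶠ n ∈ᶠ w

/-- `f` is a bijection from `A` to `B`. -/
def bijection (f A B : ℕ) : Fm :=
  func f A B ∧ᶠ allIn B fun y => ex fun x => all fun x' => app f x' y ↔ᶠ x' =ᶠ x

/-- `s` is finite. -/
def finite (s : ℕ) : Fm :=
  ex fun n => ex fun f => natural n ∧ᶠ bijection f n s

/-- `S = Fin(P)`, the set of finite subsets of `P`. -/
def finSubsets (S P : ℕ) : Fm :=
  all fun s => s ∈ᶠ S ↔ᶠ (allIn s fun z => z ∈ᶠ P) ∧ᶠ finite s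

/-- `E ⊆ X × X` is an equivalence relation on `X`. -/
def equivRel (E X : ℕ) : Fm :=
  (allIn E fun p => exIn X fun x => exIn X fun y => opair p x y) ∧ᶠ
  (allIn X fun x => app E x x) ∧ᶠ
  (all fun x => all fun y => app E x y →ᶠ app E y x) ∧ᶠ
  all fun x => all fun y => all fun z => app E x y →ᶠ app E y z →ᶠ app E x z

/-- `z` is the class of `s` under `E`. -/
def eqClass (z E s : ℕ) : Fm :=
  all fun t => t ∈ᶠ z ↔ᶠ app E s t

/-- `C = X / E`. -/
def quotient (C X E : ℕ) : Fm :=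
  all fun z => z ∈ᶠ C ↔ᶠ exIn X fun s => eqClass z E s

/-- For every `s ∈ S = Fin(P)`, the class of `s` is the sum in `(C, c, t)` of the `r · j i y` over
the `⟨r, ⟨i, y⟩⟩ ∈ s`: the class of `∅` is `0`, and the class of `s ∪ {p}` is the sum of `r · j i y` and
the class of `s`, for `p = ⟨r, ⟨i, y⟩⟩ ∈ P` not in `s`. -/
def sumRule (P S E C c t j : ℕ) : Fm :=
  (all fun e => all fun z => empty e →ᶠ eqClass z E e →ᶠ leftUnit C c z) ∧ᶠ
  allIn S fun s => allIn P fun p => neg (p ∈ᶠ s) →ᶠ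
  all fun r => all fun d => all fun i => all fun y => opair p r d →ᶠ opair d i y →ᶠ
  all fun f => all fun u => all fun w => app j i f →ᶠ app f y u →ᶠ app2 t r u w →ᶠ
  all fun s' => all fun z => all fun z' => insert s' s p →ᶠ eqClass z E s →ᶠ eqClass z' E s' →ᶠ
  app2 c w z z'

/-- The family `F` has a coproduct, whose underlying set is a quotient of `Fin(R × ⨆ M_i)`, the
class of a finite set of formal products `r · y` being their sum. -/
def hasCoproduct (R a m I F : ℕ) : Fm :=
  ex fun D => ex fun P => ex fun S => ex fun E =>
  disjointUnion D I F ∧ᶠ product P R D ∧ᶠ finSubsets S P ∧ᶠ equivRel E S ∧ᶠ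
  ex fun C => ex fun c => ex fun t => ex fun j =>
  quotient C S E ∧ᶠ coproduct R a m I F C c t j ∧ᶠ sumRule P S E C c t j

end Fm

/-- The sentence: for every commutative ring `R` with unit and every set-indexed family of
`R`-modules, the family has a coproduct, built from the finite subsets of `R × ⨆ M_i`. -/
def coproductSentence : lang.Sentence := Fm.closure 0 <|
  Fm.all fun R => Fm.all fun a => Fm.all fun m => Fm.commRing R a m →ᶠ
    Fm.all fun I => Fm.all fun F => Fm.moduleFamily R a m I F →ᶠ Fm.hasCoproduct R a m I F

/-! ## What the formulas say in a structure -/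

section Meaning

universe u
variable {M : Type u} [lang.Structure M]

/-- `c = {a, b}`. -/
def IsUpair (c a b : M) : Prop :=
  ∀ z, Mem z c ↔ z = a ∨ z = b

/-- `p = ⟨a, b⟩ = {{a}, {a, b}}`. -/
def IsOpair (p a b : M) : Prop :=
  ∃ s d, IsUpair s a a ∧ IsUpair d a b ∧ IsUpair p s d

/-- `t = ⟨a, ⟨b, c⟩⟩`. -/
def IsTriple (t a b c : M) : Prop :=
  ∃ q, IsOpair q b c ∧ IsOpair t a q

/-- `P = A × B`. -/
def IsProduct (P A B : M) : Prop :=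
  ∀ p, Mem p P ↔ ∃ x, Mem x A ∧ ∃ y, Mem y B ∧ IsOpair p x y

/-- `⟨x, y⟩ ∈ f`, that is `f x = y` if `f` is a function. -/
def App (f x y : M) : Prop :=
  ∃ p, Mem p f ∧ IsOpair p x y

/-- `f` is a function from `A` to `B` (a set of ordered pairs). -/
def IsFunc (f A B : M) : Prop :=
  (∀ p, Mem p f → ∃ x, Mem x A ∧ ∃ y, Mem y B ∧ IsOpair p x y) ∧
  ∀ x, Mem x A → ∃ y, ∀ y', App f x y' ↔ y' = y

/-- `f ⟨x, y⟩ = z`. -/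
def App₂ (f x y z : M) : Prop :=
  ∃ p, IsOpair p x y ∧ App f p z

/-- `f` is a function from `A × B` to `C`. -/
def IsOp (f A B C : M) : Prop :=
  ∃ P, IsProduct P A B ∧ IsFunc f P C

/-- `e ∈ A` and `f ⟨e, x⟩ = x` for all `x ∈ A`. -/
def IsLeftUnit (A f e : M) : Prop :=
  Mem e A ∧ ∀ x, Mem x A → App₂ f e x x

/-- The binary operation `f` on `A` is associative. -/
def IsAssoc (A f : M) : Prop :=
  ∀ x, Mem x A → ∀ y, Mem y A → ∀ z, Mem z A → ∀ u w t,
  App₂ f x y u → App₂ f y z w → App₂ f u z t → App₂ f x w t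

/-- The binary operation `f` on `A` is commutative. -/
def IsComm (A f : M) : Prop :=
  ∀ x, Mem x A → ∀ y, Mem y A → ∀ u, App₂ f x y u → App₂ f y x u

/-- `(A, f)` is an abelian group. -/
def IsAbGroup (A f : M) : Prop :=
  IsOp f A A A ∧ IsAssoc A f ∧ IsComm A f ∧
  ∃ o, IsLeftUnit A f o ∧ ∀ x, Mem x A → ∃ y, Mem y A ∧ App₂ f x y o

/-- `R` is a commutative ring with unit, with addition `a` and multiplication `m`. -/
def IsCommRing (R a m : M) : Prop :=
  IsAbGroup R a ∧ IsOp m R R R ∧ IsAssoc R m ∧ IsComm R m ∧ (∃ e, IsLeftUnit R m e) ∧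
  ∀ x, Mem x R → ∀ y, Mem y R → ∀ z, Mem z R →
  ∀ s u w t,
  App₂ a y z s → App₂ m x y u → App₂ m x z w → App₂ a u w t → App₂ m x s t

/-- `N` is a module over the ring `(R, a, m)`, with addition `b` and scalar multiplication
`s : R × N → N`. The last four clauses: `r (x + y) = r x + r y`, `(q + r) x = q x + r x`,
`(q r) x = q (r x)`, and `1 x = x`. -/
def IsModule (R a m N b s : M) : Prop :=
  IsAbGroup N b ∧ IsOp s R N N ∧
  (∀ r, Mem r R → ∀ x, Mem x N → ∀ y, Mem y N →
    ∀ z u w t,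
    App₂ b x y z → App₂ s r x u → App₂ s r y w → App₂ b u w t → App₂ s r z t) ∧
  (∀ q, Mem q R → ∀ r, Mem r R → ∀ x, Mem x N →
    ∀ z u w t,
    App₂ a q r z → App₂ s q x u → App₂ s r x w → App₂ b u w t → App₂ s z x t) ∧
  (∀ q, Mem q R → ∀ r, Mem r R → ∀ x, Mem x N →
    ∀ z w t,
    App₂ m q r z → App₂ s r x w → App₂ s q w t → App₂ s z x t) ∧
  ∀ e, IsLeftUnit R m e → ∀ x, Mem x N → App₂ s e x x

/-- `f` is an `R`-linear map from `(N, b, s)` to `(N', b', s')`. -/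
def IsLinear (R N b s N' b' s' f : M) : Prop :=
  IsFunc f N N' ∧
  (∀ x y z x' y' z',
    App₂ b x y z → App f x x' → App f y y' → App f z z' → App₂ b' x' y' z') ∧
  ∀ r, Mem r R → ∀ x z x' z',
    App₂ s r x z → App f x x' → App f z z' → App₂ s' r x' z'

/-- `F i = ⟨N, ⟨b, s⟩⟩`. -/
def FamAt (F i N b s : M) : Prop :=
  ∃ T, App F i T ∧ IsTriple T N b s

/-- `F` is a function on the set `I` whose value at each `i ∈ I` is an `R`-module
`M_i = ⟨N, ⟨b, s⟩⟩`. -/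
def IsModuleFamily (R a m I F : M) : Prop :=
  (∃ B, IsFunc F I B) ∧ ∀ i, Mem i I → ∃ N b s,
  FamAt F i N b s ∧ IsModule R a m N b s

/-- `g` is a function on `I` whose value at each `i ∈ I` is an `R`-linear map from `M_i = F i`
to `(N, b, s)`. -/
def IsCocone (R I F N b s g : M) : Prop :=
  (∃ B, IsFunc g I B) ∧ ∀ i, Mem i I → ∀ N' b' s',
  FamAt F i N' b' s' → ∃ f, App g i f ∧ IsLinear R N' b' s' N b s f

/-- `h ∘ (g i) = g' i` for all `i ∈ I`. -/
def Factors (I g h g' : M) : Prop :=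
  ∀ i, Mem i I → ∀ f f', App g i f → App g' i f' →
  ∀ x y z, App f x y → App h y z → App f' x z

/-- The `R`-module `(C, c, t)` with the maps `j i : M_i → C` is a coproduct of the family `F`:
each family of linear maps `g i : M_i → N` is `h ∘ j i` for exactly one linear `h : C → N`. -/
def IsCoproduct (R a m I F C c t j : M) : Prop :=
  IsModule R a m C c t ∧ IsCocone R I F C c t j ∧
  ∀ N b s g,
  IsModule R a m N b s → IsCocone R I F N b s g →
  ∃ h, ∀ h', (IsLinear R C c t N b s h' ∧ Factors I j h' g) ↔ h' = h

/-- `D` is the disjoint union of the `M_i`: the set of pairs `⟨i, y⟩` with `i ∈ I`, `y ∈ M_i`. -/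
def IsDisjointUnion (D I F : M) : Prop :=
  ∀ p, Mem p D ↔ ∃ i, Mem i I ∧ ∃ N b s,
  FamAt F i N b s ∧ ∃ y, Mem y N ∧ IsOpair p i y

/-- `e = ∅`. -/
def IsEmpty (e : M) : Prop :=
  ∀ z, ¬ Mem z e

/-- `u = s ∪ {p}`. -/
def IsInsert (u s p : M) : Prop :=
  ∀ z, Mem z u ↔ Mem z s ∨ z = p

/-- `∅ ∈ w`, and `x ∪ {x} ∈ w` for all `x ∈ w`. -/
def IsInductiveSet (w : M) : Prop :=
  (∃ e, Mem e w ∧ IsEmpty e) ∧ ∀ x, Mem x w → ∃ y, Mem y w ∧ IsInsert y x x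

/-- `n` is a natural number: it belongs to every inductive set. -/
def IsNatural (n : M) : Prop :=
  ∀ w, IsInductiveSet w → Mem n w

/-- `f` is a bijection from `A` to `B`. -/
def IsBijection (f A B : M) : Prop :=
  IsFunc f A B ∧ ∀ y, Mem y B → ∃ x, ∀ x', App f x' y ↔ x' = x

/-- `s` is finite. -/
def IsFinite (s : M) : Prop :=
  ∃ n f, IsNatural n ∧ IsBijection f n s

/-- `S = Fin(P)`, the set of finite subsets of `P`. -/
def IsFinSubsets (S P : M) : Prop :=
  ∀ s, Mem s S ↔ (∀ z, Mem z s → Mem z P) ∧ IsFinite s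

/-- `E ⊆ X × X` is an equivalence relation on `X`. -/
def IsEquivRel (E X : M) : Prop :=
  (∀ p, Mem p E → ∃ x, Mem x X ∧ ∃ y, Mem y X ∧ IsOpair p x y) ∧
  (∀ x, Mem x X → App E x x) ∧
  (∀ x y, App E x y → App E y x) ∧
  ∀ x y z, App E x y → App E y z → App E x z

/-- `z` is the class of `s` under `E`. -/
def IsEqClass (z E s : M) : Prop :=
  ∀ t, Mem t z ↔ App E s t

/-- `C = X / E`. -/
def IsQuotient (C X E : M) : Prop :=
  ∀ z, Mem z C ↔ ∃ s, Mem s X ∧ IsEqClass z E s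

/-- For every `s ∈ S = Fin(P)`, the class of `s` is the sum in `(C, c, t)` of the `r · j i y` over
the `⟨r, ⟨i, y⟩⟩ ∈ s`: the class of `∅` is `0`, and the class of `s ∪ {p}` is the sum of `r · j i y` and
the class of `s`, for `p = ⟨r, ⟨i, y⟩⟩ ∈ P` not in `s`. -/
def SumRule (P S E C c t j : M) : Prop :=
  (∀ e z, IsEmpty e → IsEqClass z E e → IsLeftUnit C c z) ∧
  ∀ s, Mem s S → ∀ p, Mem p P → ¬ Mem p s →
  ∀ r d i y, IsOpair p r d → IsOpair d i y →
  ∀ f u w, App j i f → App f y u → App₂ t r u w →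
  ∀ s' z z', IsInsert s' s p → IsEqClass z E s → IsEqClass z' E s' →
  App₂ c w z z'

/-- The family `F` has a coproduct, whose underlying set is a quotient of `Fin(R × ⨆ M_i)`, the
class of a finite set of formal products `r · y` being their sum. -/
def HasCoproduct (R a m I F : M) : Prop :=
  ∃ D P S E,
  IsDisjointUnion D I F ∧ IsProduct P R D ∧ IsFinSubsets S P ∧ IsEquivRel E S ∧
  ∃ C c t j,
  IsQuotient C S E ∧ IsCoproduct R a m I F C c t j ∧ SumRule P S E C c t j

variable {k : ℕ} {v : ℕ → M}

@[simp] theorem realize_upair {c a b : ℕ}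
    (h0 : c < k) (h1 : a < k) (h2 : b < k) :
    (Fm.upair c a b k).Realize v ↔
      IsUpair (v c) (v a) (v b) := by
  simp (disch := omega) only [Fm.upair, IsUpair, realize_mem, realize_eq, realize_or,
    realize_iff, realize_all, Function.update_self, Function.update_of_ne]

@[simp] theorem realize_opair {p a b : ℕ}
    (h0 : p < k) (h1 : a < k) (h2 : b < k) :
    (Fm.opair p a b k).Realize v ↔
      IsOpair (v p) (v a) (v b) := by
  simp (disch := omega) only [Fm.opair, IsOpair, realize_and, realize_ex, Function.update_self,
    Function.update_of_ne, realize_upair]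

@[simp] theorem realize_triple {t a b c : ℕ}
    (h0 : t < k) (h1 : a < k) (h2 : b < k) (h3 : c < k) :
    (Fm.triple t a b c k).Realize v ↔
      IsTriple (v t) (v a) (v b) (v c) := by
  simp (disch := omega) only [Fm.triple, IsTriple, realize_and, realize_ex,
    Function.update_self, Function.update_of_ne, realize_opair]

@[simp] theorem realize_product {P A B : ℕ}
    (h0 : P < k) (h1 : A < k) (h2 : B < k) :
    (Fm.product P A B k).Realize v ↔
      IsProduct (v P) (v A) (v B) := by
  simp (disch := omega) only [Fm.product, IsProduct, realize_mem, realize_iff, realize_all,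
    realize_exIn, Function.update_self, Function.update_of_ne, realize_opair]

@[simp] theorem realize_app {f x y : ℕ}
    (h0 : f < k) (h1 : x < k) (h2 : y < k) :
    (Fm.app f x y k).Realize v ↔
      App (v f) (v x) (v y) := by
  simp (disch := omega) only [Fm.app, App, realize_exIn, Function.update_self,
    Function.update_of_ne, realize_opair]

@[simp] theorem realize_func {f A B : ℕ}
    (h0 : f < k) (h1 : A < k) (h2 : B < k) :
    (Fm.func f A B k).Realize v ↔
      IsFunc (v f) (v A) (v B) := by
  simp (disch := omega) only [Fm.func, IsFunc, realize_eq, realize_and, realize_iff,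
    realize_all, realize_ex, realize_allIn, realize_exIn, Function.update_self,
    Function.update_of_ne, realize_opair, realize_app]

@[simp] theorem realize_app2 {f x y z : ℕ}
    (h0 : f < k) (h1 : x < k) (h2 : y < k) (h3 : z < k) :
    (Fm.app2 f x y z k).Realize v ↔
      App₂ (v f) (v x) (v y) (v z) := by
  simp (disch := omega) only [Fm.app2, App₂, realize_and, realize_ex, Function.update_self,
    Function.update_of_ne, realize_opair, realize_app]

@[simp] theorem realize_op {f A B C : ℕ}
    (h0 : f < k) (h1 : A < k) (h2 : B < k) (h3 : C < k) :
    (Fm.op f A B C k).Realize v ↔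
      IsOp (v f) (v A) (v B) (v C) := by
  simp (disch := omega) only [Fm.op, IsOp, realize_and, realize_ex, Function.update_self,
    Function.update_of_ne, realize_product, realize_func]

@[simp] theorem realize_leftUnit {A f e : ℕ}
    (h0 : A < k) (h1 : f < k) (h2 : e < k) :
    (Fm.leftUnit A f e k).Realize v ↔
      IsLeftUnit (v A) (v f) (v e) := by
  simp (disch := omega) only [Fm.leftUnit, IsLeftUnit, realize_mem, realize_and, realize_allIn,
    Function.update_self, Function.update_of_ne, realize_app2]

@[simp] theorem realize_assoc {A f : ℕ}
    (h0 : A < k) (h1 : f < k) :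
    (Fm.assoc A f k).Realize v ↔
      IsAssoc (v A) (v f) := by
  simp (disch := omega) only [Fm.assoc, IsAssoc, realize_imp, realize_all, realize_allIn,
    Function.update_self, Function.update_of_ne, realize_app2]

@[simp] theorem realize_comm {A f : ℕ}
    (h0 : A < k) (h1 : f < k) :
    (Fm.comm A f k).Realize v ↔
      IsComm (v A) (v f) := by
  simp (disch := omega) only [Fm.comm, IsComm, realize_imp, realize_all, realize_allIn,
    Function.update_self, Function.update_of_ne, realize_app2]

@[simp] theorem realize_abGroup {A f : ℕ}
    (h0 : A < k) (h1 : f < k) :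
    (Fm.abGroup A f k).Realize v ↔
      IsAbGroup (v A) (v f) := by
  simp (disch := omega) only [Fm.abGroup, IsAbGroup, realize_and, realize_ex, realize_allIn,
    realize_exIn, Function.update_self, Function.update_of_ne, realize_app2, realize_op,
    realize_leftUnit, realize_assoc, realize_comm]

@[simp] theorem realize_commRing {R a m : ℕ}
    (h0 : R < k) (h1 : a < k) (h2 : m < k) :
    (Fm.commRing R a m k).Realize v ↔
      IsCommRing (v R) (v a) (v m) := by
  simp (disch := omega) only [Fm.commRing, IsCommRing, realize_imp, realize_and, realize_all,
    realize_ex, realize_allIn, Function.update_self, Function.update_of_ne, realize_app2,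
    realize_op, realize_leftUnit, realize_assoc, realize_comm, realize_abGroup]

@[simp] theorem realize_module {R a m N b s : ℕ}
    (h0 : R < k) (h1 : a < k) (h2 : m < k) (h3 : N < k) (h4 : b < k) (h5 : s < k) :
    (Fm.module R a m N b s k).Realize v ↔
      IsModule (v R) (v a) (v m) (v N) (v b) (v s) := by
  simp (disch := omega) only [Fm.module, IsModule, realize_imp, realize_and, realize_all,
    realize_allIn, Function.update_self, Function.update_of_ne, realize_app2, realize_op,
    realize_leftUnit, realize_abGroup]

@[simp] theorem realize_linear {R N b s N' b' s' f : ℕ}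
    (h0 : R < k) (h1 : N < k) (h2 : b < k) (h3 : s < k) (h4 : N' < k) (h5 : b' < k) (h6 : s' < k) (h7 : f < k) :
    (Fm.linear R N b s N' b' s' f k).Realize v ↔
      IsLinear (v R) (v N) (v b) (v s) (v N') (v b') (v s') (v f) := by
  simp (disch := omega) only [Fm.linear, IsLinear, realize_imp, realize_and, realize_all,
    realize_allIn, Function.update_self, Function.update_of_ne, realize_app, realize_func,
    realize_app2]

@[simp] theorem realize_famAt {F i N b s : ℕ}
    (h0 : F < k) (h1 : i < k) (h2 : N < k) (h3 : b < k) (h4 : s < k) :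
    (Fm.famAt F i N b s k).Realize v ↔
      FamAt (v F) (v i) (v N) (v b) (v s) := by
  simp (disch := omega) only [Fm.famAt, FamAt, realize_and, realize_ex, Function.update_self,
    Function.update_of_ne, realize_triple, realize_app]

@[simp] theorem realize_moduleFamily {R a m I F : ℕ}
    (h0 : R < k) (h1 : a < k) (h2 : m < k) (h3 : I < k) (h4 : F < k) :
    (Fm.moduleFamily R a m I F k).Realize v ↔
      IsModuleFamily (v R) (v a) (v m) (v I) (v F) := by
  simp (disch := omega) only [Fm.moduleFamily, IsModuleFamily, realize_and, realize_ex,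
    realize_allIn, Function.update_self, Function.update_of_ne, realize_func, realize_module,
    realize_famAt]

@[simp] theorem realize_cocone {R I F N b s g : ℕ}
    (h0 : R < k) (h1 : I < k) (h2 : F < k) (h3 : N < k) (h4 : b < k) (h5 : s < k) (h6 : g < k) :
    (Fm.cocone R I F N b s g k).Realize v ↔
      IsCocone (v R) (v I) (v F) (v N) (v b) (v s) (v g) := by
  simp (disch := omega) only [Fm.cocone, IsCocone, realize_imp, realize_and, realize_all,
    realize_ex, realize_allIn, Function.update_self, Function.update_of_ne, realize_app,
    realize_func, realize_linear, realize_famAt]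

@[simp] theorem realize_factors {I g h g' : ℕ}
    (h0 : I < k) (h1 : g < k) (h2 : h < k) (h3 : g' < k) :
    (Fm.factors I g h g' k).Realize v ↔
      Factors (v I) (v g) (v h) (v g') := by
  simp (disch := omega) only [Fm.factors, Factors, realize_imp, realize_all, realize_allIn,
    Function.update_self, Function.update_of_ne, realize_app]

@[simp] theorem realize_coproduct {R a m I F C c t j : ℕ}
    (h0 : R < k) (h1 : a < k) (h2 : m < k) (h3 : I < k) (h4 : F < k) (h5 : C < k) (h6 : c < k) (h7 : t < k) (h8 : j < k) :
    (Fm.coproduct R a m I F C c t j k).Realize v ↔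
      IsCoproduct (v R) (v a) (v m) (v I) (v F) (v C) (v c) (v t) (v j) := by
  simp (disch := omega) only [Fm.coproduct, IsCoproduct, realize_eq, realize_imp, realize_and,
    realize_iff, realize_all, realize_ex, Function.update_self, Function.update_of_ne,
    realize_module, realize_linear, realize_cocone, realize_factors]

@[simp] theorem realize_disjointUnion {D I F : ℕ}
    (h0 : D < k) (h1 : I < k) (h2 : F < k) :
    (Fm.disjointUnion D I F k).Realize v ↔
      IsDisjointUnion (v D) (v I) (v F) := by
  simp (disch := omega) only [Fm.disjointUnion, IsDisjointUnion, realize_mem, realize_and,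
    realize_iff, realize_all, realize_ex, realize_exIn, Function.update_self,
    Function.update_of_ne, realize_opair, realize_famAt]

@[simp] theorem realize_empty {e : ℕ}
    (h0 : e < k) :
    (Fm.empty e k).Realize v ↔
      IsEmpty (v e) := by
  simp (disch := omega) only [Fm.empty, IsEmpty, realize_mem, realize_neg, realize_all,
    Function.update_self, Function.update_of_ne]

@[simp] theorem realize_insert {u s p : ℕ}
    (h0 : u < k) (h1 : s < k) (h2 : p < k) :
    (Fm.insert u s p k).Realize v ↔
      IsInsert (v u) (v s) (v p) := by
  simp (disch := omega) only [Fm.insert, IsInsert, realize_mem, realize_eq, realize_or,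
    realize_iff, realize_all, Function.update_self, Function.update_of_ne]

@[simp] theorem realize_inductiveSet {w : ℕ}
    (h0 : w < k) :
    (Fm.inductiveSet w k).Realize v ↔
      IsInductiveSet (v w) := by
  simp (disch := omega) only [Fm.inductiveSet, IsInductiveSet, realize_and, realize_allIn,
    realize_exIn, Function.update_self, Function.update_of_ne, realize_empty, realize_insert]

@[simp] theorem realize_natural {n : ℕ}
    (h0 : n < k) :
    (Fm.natural n k).Realize v ↔
      IsNatural (v n) := by
  simp (disch := omega) only [Fm.natural, IsNatural, realize_mem, realize_imp, realize_all,
    Function.update_self, Function.update_of_ne, realize_inductiveSet]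

@[simp] theorem realize_bijection {f A B : ℕ}
    (h0 : f < k) (h1 : A < k) (h2 : B < k) :
    (Fm.bijection f A B k).Realize v ↔
      IsBijection (v f) (v A) (v B) := by
  simp (disch := omega) only [Fm.bijection, IsBijection, realize_eq, realize_and, realize_iff,
    realize_all, realize_ex, realize_allIn, Function.update_self, Function.update_of_ne,
    realize_app, realize_func]

@[simp] theorem realize_finite {s : ℕ}
    (h0 : s < k) :
    (Fm.finite s k).Realize v ↔
      IsFinite (v s) := by
  simp (disch := omega) only [Fm.finite, IsFinite, realize_and, realize_ex,
    Function.update_self, Function.update_of_ne, realize_natural, realize_bijection]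

@[simp] theorem realize_finSubsets {S P : ℕ}
    (h0 : S < k) (h1 : P < k) :
    (Fm.finSubsets S P k).Realize v ↔
      IsFinSubsets (v S) (v P) := by
  simp (disch := omega) only [Fm.finSubsets, IsFinSubsets, realize_mem, realize_and,
    realize_iff, realize_all, realize_allIn, Function.update_self, Function.update_of_ne,
    realize_finite]

@[simp] theorem realize_equivRel {E X : ℕ}
    (h0 : E < k) (h1 : X < k) :
    (Fm.equivRel E X k).Realize v ↔
      IsEquivRel (v E) (v X) := by
  simp (disch := omega) only [Fm.equivRel, IsEquivRel, realize_imp, realize_and, realize_all,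
    realize_allIn, realize_exIn, Function.update_self, Function.update_of_ne, realize_opair,
    realize_app]

@[simp] theorem realize_eqClass {z E s : ℕ}
    (h0 : z < k) (h1 : E < k) (h2 : s < k) :
    (Fm.eqClass z E s k).Realize v ↔
      IsEqClass (v z) (v E) (v s) := by
  simp (disch := omega) only [Fm.eqClass, IsEqClass, realize_mem, realize_iff, realize_all,
    Function.update_self, Function.update_of_ne, realize_app]

@[simp] theorem realize_quotient {C X E : ℕ}
    (h0 : C < k) (h1 : X < k) (h2 : E < k) :
    (Fm.quotient C X E k).Realize v ↔
      IsQuotient (v C) (v X) (v E) := by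
  simp (disch := omega) only [Fm.quotient, IsQuotient, realize_mem, realize_iff, realize_all,
    realize_exIn, Function.update_self, Function.update_of_ne, realize_eqClass]

@[simp] theorem realize_sumRule {P S E C c t j : ℕ}
    (h0 : P < k) (h1 : S < k) (h2 : E < k) (h3 : C < k) (h4 : c < k) (h5 : t < k) (h6 : j < k) :
    (Fm.sumRule P S E C c t j k).Realize v ↔
      SumRule (v P) (v S) (v E) (v C) (v c) (v t) (v j) := by
  simp (disch := omega) only [Fm.sumRule, SumRule, realize_mem, realize_neg, realize_imp,
    realize_and, realize_all, realize_allIn, Function.update_self, Function.update_of_ne,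
    realize_opair, realize_app, realize_app2, realize_leftUnit, realize_empty, realize_insert,
    realize_eqClass]

@[simp] theorem realize_hasCoproduct {R a m I F : ℕ}
    (h0 : R < k) (h1 : a < k) (h2 : m < k) (h3 : I < k) (h4 : F < k) :
    (Fm.hasCoproduct R a m I F k).Realize v ↔
      HasCoproduct (v R) (v a) (v m) (v I) (v F) := by
  simp (disch := omega) only [Fm.hasCoproduct, HasCoproduct, realize_and, realize_ex,
    Function.update_self, Function.update_of_ne, realize_product, realize_coproduct,
    realize_disjointUnion, realize_finSubsets, realize_equivRel, realize_quotient,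
    realize_sumRule]

/-- What it means for a non-empty structure to satisfy `coproductSentence`. -/
theorem realize_coproductSentence [Nonempty M] : M ⊨ coproductSentence ↔
    ∀ R a m : M, IsCommRing R a m →
      ∀ I F : M, IsModuleFamily R a m I F → HasCoproduct R a m I F := by
  rw [coproductSentence, realize_closure]
  simp (disch := omega) only [realize_imp, realize_all, realize_commRing, realize_moduleFamily,
    realize_hasCoproduct, Function.update_self, Function.update_of_ne, forall_const]

variable (M) in
/-- What it means for a structure to be a model of ZFG[0]. -/
structure IsZFGModel : Prop where
  extensionality : ∀ a b : M, (∀ x, Mem x a ↔ Mem x b) → a = b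
  foundation : ∀ a : M, (∃ x, Mem x a) → ∃ x, Mem x a ∧ ∀ y, Mem y a → ¬ Mem y x
  pairing : ∀ a b : M, ∃ c, ∀ x, Mem x c ↔ x = a ∨ x = b
  union : ∀ a : M, ∃ u, ∀ x, Mem x u ↔ ∃ y, Mem y a ∧ Mem x y
  infinity : ∃ w : M, (∃ e, Mem e w ∧ ∀ z, ¬ Mem z e) ∧
    ∀ x, Mem x w → ∃ y, Mem y w ∧ ∀ z, Mem z y ↔ Mem z x ∨ z = x
  replacement : ∀ (n : ℕ) (φ : lang.Formula (Fin (n + 1) ⊕ Fin 2)) (p : Fin (n + 1) → M) (a : M),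
    (∀ x, Mem x a → ∀ y z, φ.Realize (Sum.elim p ![x, y]) → φ.Realize (Sum.elim p ![x, z]) →
      y = z) → ∃ b, ∀ y, Mem y b ↔ ∃ x, Mem x a ∧ φ.Realize (Sum.elim p ![x, y])
  leAntisymm : ∀ x y : M, Le x y → Le y x → x = y
  leTrans : ∀ x y z : M, Le x y → Le y z → Le x z
  leTotal : ∀ x y : M, Le x y ∨ Le y x
  leMinimal : ∀ (n : ℕ) (φ : lang.Formula (Fin (n + 1) ⊕ Fin 1)) (p : Fin (n + 1) → M),
    (∃ x, φ.Realize (Sum.elim p ![x])) →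
      ∃ x, φ.Realize (Sum.elim p ![x]) ∧ ∀ y, φ.Realize (Sum.elim p ![y]) → Le x y

theorem realize_replacement {n : ℕ} {φ : lang.Formula (Fin (n + 1) ⊕ Fin 2)} :
    M ⊨ Fm.closure n (Fm.replacement φ) ↔ ∀ (p : Fin (n + 1) → M) (a : M),
    (∀ x, Mem x a → ∀ y z, φ.Realize (Sum.elim p ![x, y]) → φ.Realize (Sum.elim p ![x, z]) →
      y = z) → ∃ b, ∀ y, Mem y b ↔ ∃ x, Mem x a ∧ φ.Realize (Sum.elim p ![x, y]) := by
  rw [realize_closure]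
  refine forall_congr' fun p => ?_
  have h : ∀ i : Fin (n + 1), Fin.ofNat (n + 1) i = i := fun i => by simp
  have h' : ∀ i : Fin (n + 1), (i : ℕ) < n + 1 := fun i => i.2
  simp (disch := first | omega | (have := h' ‹_›; omega)) only [Fm.replacement, realize_imp,
    realize_all, realize_ex, realize_allIn, realize_exIn, realize_iff, realize_mem, realize_eq,
    realize_inst₂, Function.update_self, Function.update_of_ne, h]

theorem realize_leMinimal {n : ℕ} {φ : lang.Formula (Fin (n + 1) ⊕ Fin 1)} :
    M ⊨ Fm.closure n (Fm.leMinimal φ) ↔ ∀ p : Fin (n + 1) → M,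
    (∃ x, φ.Realize (Sum.elim p ![x])) →
      ∃ x, φ.Realize (Sum.elim p ![x]) ∧ ∀ y, φ.Realize (Sum.elim p ![y]) → Le x y := by
  rw [realize_closure]
  refine forall_congr' fun p => ?_
  have h : ∀ i : Fin (n + 1), Fin.ofNat (n + 1) i = i := fun i => by simp
  simp (disch := omega) only [Fm.leMinimal, realize_imp,
    realize_all, realize_ex, realize_and, realize_le,
    realize_inst₁, Function.update_self, Function.update_of_ne, h]

theorem model_zfg₀_iff [Nonempty M] : M ⊨ zfg₀ ↔ IsZFGModel M := by
  rw [FirstOrder.Language.Theory.model_iff]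
  constructor
  · intro h
    constructor
    · simpa (disch := omega) [realize_closure, Fm.extensionality] using h _ .extensionality
    · simpa (disch := omega) [realize_closure, Fm.foundation] using h _ .foundation
    · simpa (disch := omega) [realize_closure, Fm.pairing] using h _ .pairing
    · simpa (disch := omega) [realize_closure, Fm.union] using h _ .union
    · simpa (disch := omega) [realize_closure, Fm.infinity] using h _ .infinity
    · exact fun n φ => realize_replacement.1 (h _ (.replacement n φ))
    · simpa (disch := omega) [realize_closure, Fm.leAntisymm] using h _ .leAntisymm
    · simpa (disch := omega) [realize_closure, Fm.leTrans] using h _ .leTrans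
    · simpa (disch := omega) [realize_closure, Fm.leTotal] using h _ .leTotal
    · exact fun n φ => realize_leMinimal.1 (h _ (.leMinimal n φ))
  · rintro h _ (_ | _ | _ | _ | _ | ⟨n, φ⟩ | _ | _ | _ | ⟨n, φ⟩)
    · simpa (disch := omega) [realize_closure, Fm.extensionality] using h.extensionality
    · simpa (disch := omega) [realize_closure, Fm.foundation] using h.foundation
    · simpa (disch := omega) [realize_closure, Fm.pairing] using h.pairing
    · simpa (disch := omega) [realize_closure, Fm.union] using h.union
    · simpa (disch := omega) [realize_closure, Fm.infinity] using h.infinity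
    · exact realize_replacement.2 (h.replacement n φ)
    · simpa (disch := omega) [realize_closure, Fm.leAntisymm] using h.leAntisymm
    · simpa (disch := omega) [realize_closure, Fm.leTrans] using h.leTrans
    · simpa (disch := omega) [realize_closure, Fm.leTotal] using h.leTotal
    · exact realize_leMinimal.2 (h.leMinimal n φ)

end Meaning

end ZFG

/-! The argument takes place inside an arbitrary non-empty model `M` of the theory. Power set is
absent, so three things need care: the set of finite subsets must be built by replacement, every set
formed must come from a first-order definable condition, and choices of representatives must be
avoided.

Definability is handled by the classes `DefPred` and `DefFun`. Their instances follow the syntax of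
a Lean predicate and produce a formula with parameters, so `exists_replacement`, `exists_sep` and
`exists_image` apply directly to predicates on `M`. The description operator `the` turns a uniquely
characterised object into a definable function (`DefFun.the`).

The finite subsets of `P` form a set because, for each natural number `n` of `M`, the subsets of
size `n` do (`exists_subsets_of_card`), and replacement collects these sets over all `n`. Induction
over finite subsets is available for definable properties. With it, `exists_sum` defines the sum of
a family of values over finite subsets, commutativity making the result independent of the order of
insertion.

For the coproduct, a finite set of formal products `⟨r, ⟨i, y⟩⟩` has a sum along each cocone. Two
finite sets are identified when their sums agree along every cocone into every module of `M`. This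
quantifies over a proper class, but it is a first-order condition, so separation yields the
equivalence relation `E`. Every cocone then induces an evaluation `ev` on the quotient `C`, and all
evaluations together separate points (`ev_ext`). The operations and inclusions of `C` are determined
by what they must become under evaluation, and each module law in `C` follows from the same law in
the targets.

It remains to see that the required elements of `C` exist. The difficulty is that a set cannot
contain the same formal product twice, so a union of two sets need not represent the sum. In
`exists_reduced_add_term` this is avoided by keeping at most one term for each index: two terms with
the same index `i` are merged into `1 · (r y + r' y')`. Sums and scalar multiples of representable
elements are then representable (`exists_add`, `exists_smul`).

In the universal property, the map out of `C` is the evaluation. Its uniqueness is an induction on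
finite subsets, using the recursion `cls_ins` for classes. -/

namespace ZFG

/-! ## Definite descriptions -/

open Classical in
/-- The object with the property `Q`, if there is exactly one. -/
noncomputable def the {M : Type*} [Nonempty M] (Q : M → Prop) : M :=
  if h : ∃ y, ∀ z, Q z ↔ z = y then h.choose else Classical.arbitrary M

theorem the_eq {M : Type*} [Nonempty M] {Q : M → Prop} {y : M} (h : ∀ z, Q z ↔ z = y) : the Q = y := by
  have h' : ∃ y, ∀ z, Q z ↔ z = y := ⟨y, h⟩
  rw [the, dif_pos h']
  exact (h _).1 ((h'.choose_spec _).2 rfl)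

theorem the_eq_of_unique {M : Type*} [Nonempty M] {Q : M → Prop} {y : M} (hy : Q y)
    (h : ∀ z, Q z → z = y) : the Q = y :=
  the_eq fun z => ⟨h z, fun e => e ▸ hy⟩

/-! ## Definability with parameters -/

section Definability

universe u
variable {M : Type u} [lang.Structure M]

/-- A property of valuations which is defined by a formula with parameters from `M`. -/
class DefPred (P : (ℕ → M) → Prop) : Prop where
  exists_formula : ∃ φ : lang.Formula (M ⊕ ℕ), ∀ v, φ.Realize (Sum.elim id v) ↔ P v

/-- A function of valuations whose graph is defined by a formula with parameters from `M`. -/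
class DefFun (t : (ℕ → M) → M) : Prop where
  graph : DefPred fun w : ℕ → M => w 0 = t fun i => w (i + 1)

theorem DefPred.congr {P Q : (ℕ → M) → Prop} (hP : DefPred P) (h : ∀ v, P v ↔ Q v) :
    DefPred Q := by
  rwa [← show P = Q from funext fun v => propext (h v)]

theorem DefPred.rename {P : (ℕ → M) → Prop} (hP : DefPred P) (ρ : ℕ → ℕ) :
    DefPred fun w => P fun i => w (ρ i) := by
  obtain ⟨φ, hφ⟩ := hP
  refine ⟨φ.relabel (Sum.map id ρ), fun v => ?_⟩
  rw [FirstOrder.Language.Formula.realize_relabel, ← hφ]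
  refine iff_of_eq (congrArg _ ?_)
  funext i
  rcases i with i | i <;> rfl

/-- Together with the following instances, this lets instance search read a formula off the shape of
a Lean predicate. -/
instance DefPred.imp {P Q : (ℕ → M) → Prop} [hP : DefPred P] [hQ : DefPred Q] :
    DefPred fun v => P v → Q v := by
  obtain ⟨φ, hφ⟩ := hP
  obtain ⟨ψ, hψ⟩ := hQ
  exact ⟨FirstOrder.Language.BoundedFormula.imp φ ψ, fun v => by
    rw [← hφ, ← hψ, FirstOrder.Language.Formula.realize_imp]⟩

instance DefPred.not {P : (ℕ → M) → Prop} [hP : DefPred P] : DefPred fun v => ¬ P v := by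
  obtain ⟨φ, hφ⟩ := hP
  exact ⟨φ.not, fun v => by rw [← hφ, FirstOrder.Language.Formula.realize_not]⟩

instance DefPred.and {P Q : (ℕ → M) → Prop} [hP : DefPred P] [hQ : DefPred Q] :
    DefPred fun v => P v ∧ Q v := by
  obtain ⟨φ, hφ⟩ := hP
  obtain ⟨ψ, hψ⟩ := hQ
  exact ⟨φ ⊓ ψ, fun v => by rw [← hφ, ← hψ, FirstOrder.Language.Formula.realize_inf]⟩

instance DefPred.or {P Q : (ℕ → M) → Prop} [hP : DefPred P] [hQ : DefPred Q] :
    DefPred fun v => P v ∨ Q v := by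
  obtain ⟨φ, hφ⟩ := hP
  obtain ⟨ψ, hψ⟩ := hQ
  exact ⟨φ ⊔ ψ, fun v => by rw [← hφ, ← hψ, FirstOrder.Language.Formula.realize_sup]⟩

instance DefPred.iff {P Q : (ℕ → M) → Prop} [hP : DefPred P] [hQ : DefPred Q] :
    DefPred fun v => P v ↔ Q v := by
  obtain ⟨φ, hφ⟩ := hP
  obtain ⟨ψ, hψ⟩ := hQ
  exact ⟨FirstOrder.Language.BoundedFormula.iff φ ψ, fun v => by
    rw [← hφ, ← hψ, FirstOrder.Language.Formula.realize_iff]⟩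

/-- Variables are treated as de Bruijn indices: under the quantifier the bound variable is number 0
and the outer variables move up by one. The relabelling turns variable 0 into the bound one and
undoes the shift on the others. -/
instance DefPred.forall {P : (ℕ → M) → M → Prop}
    [hP : DefPred fun w : ℕ → M => P (fun i => w (i + 1)) (w 0)] :
    DefPred fun v => ∀ x, P v x := by
  obtain ⟨φ, hφ⟩ := hP
  refine ⟨(FirstOrder.Language.BoundedFormula.relabel (fun i : M ⊕ ℕ => match i with
    | .inl c => (Sum.inl (Sum.inl c) : (M ⊕ ℕ) ⊕ Fin 1)
    | .inr 0 => Sum.inr 0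
    | .inr (i + 1) => Sum.inl (Sum.inr i)) φ).all, fun v => ?_⟩
  unfold FirstOrder.Language.Formula.Realize
  rw [FirstOrder.Language.BoundedFormula.realize_all]
  refine forall_congr' fun x => ?_
  rw [← show φ.Realize (Sum.elim id (fun i => match i with | 0 => x | i + 1 => v i)) ↔ P v x from
    hφ _]
  unfold FirstOrder.Language.Formula.Realize
  erw [FirstOrder.Language.BoundedFormula.realize_relabel]
  refine iff_of_eq ?_
  congr 1
  · funext i
    rcases i with i | _ | i <;> simp [Fin.snoc]
  · exact Subsingleton.elim _ _

instance DefPred.exists {P : (ℕ → M) → M → Prop}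
    [hP : DefPred fun w : ℕ → M => P (fun i => w (i + 1)) (w 0)] :
    DefPred fun v => ∃ x, P v x :=
  DefPred.congr (P := fun v => ¬ ∀ x, ¬ P v x) inferInstance fun v => by simp

theorem DefPred.eq_var (i j : ℕ) : DefPred fun v : ℕ → M => v i = v j :=
  ⟨FirstOrder.Language.Term.equal (L := lang) (FirstOrder.Language.Term.var (.inr i))
    (FirstOrder.Language.Term.var (.inr j)), fun v => by simp⟩

theorem DefPred.eq_const (i : ℕ) (c : M) : DefPred fun v : ℕ → M => v i = c :=
  ⟨FirstOrder.Language.Term.equal (L := lang) (FirstOrder.Language.Term.var (.inr i))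
    (FirstOrder.Language.Term.var (.inl c)), fun v => by simp⟩

theorem DefPred.mem_var (i j : ℕ) : DefPred fun v : ℕ → M => Mem (v i) (v j) :=
  ⟨FirstOrder.Language.Relations.formula₂ (L := lang) Rel.mem
    (FirstOrder.Language.Term.var (.inr i)) (FirstOrder.Language.Term.var (.inr j)),
    fun _ => FirstOrder.Language.Formula.realize_rel₂⟩

instance DefFun.var (i : ℕ) : DefFun fun v : ℕ → M => v i := ⟨DefPred.eq_var _ _⟩

instance DefFun.const (c : M) : DefFun fun _ : ℕ → M => c := ⟨DefPred.eq_const _ _⟩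

instance DefFun.rename {t : (ℕ → M) → M} [h : DefFun t] (ρ : ℕ → ℕ) :
    DefFun fun w : ℕ → M => t fun i => w (ρ i) :=
  ⟨h.graph.rename fun i => match i with | 0 => 0 | i + 1 => ρ i + 1⟩

/-- The language has no function symbols, so a definable function cannot be inserted as a term. Its
value is named by an existential quantifier through its graph. -/
theorem DefPred.subst {P : (ℕ → M) → M → Prop} {t : (ℕ → M) → M} [ht : DefFun t]
    (hP : DefPred fun w : ℕ → M => P (fun i => w (i + 1)) (w 0)) : DefPred fun v => P v (t v) := by
  have := ht.graph
  exact DefPred.congr (P := fun v => ∃ x, x = t v ∧ P v x) inferInstance fun v => by simp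

theorem DefPred.subst₂ {P : M → M → Prop} {t u : (ℕ → M) → M} [DefFun t] [DefFun u]
    (hP : DefPred fun w : ℕ → M => P (w 0) (w 1)) : DefPred fun v => P (t v) (u v) :=
  DefPred.subst (P := fun v x => P (t v) x) <|
    DefPred.subst (P := fun v y => P y (v 0)) (t := fun w => t fun i => w (i + 1)) hP

instance DefPred.eq {t u : (ℕ → M) → M} [DefFun t] [DefFun u] :
    DefPred fun v => t v = u v :=
  DefPred.subst₂ (P := fun x y => x = y) (DefPred.eq_var 0 1)

instance DefPred.mem {t u : (ℕ → M) → M} [DefFun t] [DefFun u] :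
    DefPred fun v => Mem (t v) (u v) :=
  DefPred.subst₂ (DefPred.mem_var 0 1)

theorem DefFun.subst₁ {f : M → M} {t : (ℕ → M) → M} [DefFun t]
    (hf : DefFun fun w : ℕ → M => f (w 0)) : DefFun fun v => f (t v) :=
  ⟨DefPred.subst₂ (P := fun y x => y = f x) (t := fun w => w 0)
    (u := fun w => t fun i => w (i + 1)) (hf.graph.rename fun i => match i with
      | 0 => 0
      | _ + 1 => 1)⟩

instance DefFun.the [Nonempty M] {Q : (ℕ → M) → M → Prop}
    [hQ : DefPred fun w : ℕ → M => Q (fun i => w (i + 1)) (w 0)] :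
    DefFun fun v => ZFG.the (Q v) := by
  -- The graph below uses `Q` under one and under two further quantifiers, which requires these
  -- shifted copies. When no unique object exists, the value is a fixed default, which is a
  -- parameter from `M`.
  have h₁ : DefPred fun w : ℕ → M => Q (fun i => w (i + 1 + 1)) (w 0) :=
    hQ.rename fun i => match i with | 0 => 0 | i + 1 => i + 2
  have h₂ : DefPred fun w : ℕ → M => Q (fun i => w (i + 1 + 1 + 1)) (w 0) :=
    hQ.rename fun i => match i with | 0 => 0 | i + 1 => i + 3
  refine ⟨DefPred.congr (P := fun w => (∀ z, Q (fun i => w (i + 1)) z ↔ z = w 0) ∨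
    (¬ ∃ y, ∀ z, Q (fun i => w (i + 1)) z ↔ z = y) ∧ w 0 = Classical.arbitrary M)
    inferInstance fun w => ?_⟩
  constructor
  · rintro (h | ⟨h, h'⟩)
    · exact (the_eq h).symm
    · rw [h', ZFG.the, dif_neg h]
  · intro h
    by_cases h' : ∃ y, ∀ z, Q (fun i => w (i + 1)) z ↔ z = y
    · obtain ⟨y, hy⟩ := h'
      rw [the_eq hy] at h
      exact Or.inl (h ▸ hy)
    · exact Or.inr ⟨h', by rw [h, ZFG.the, dif_neg h']⟩

-- The axiom schemes allow only finitely many parameters, while `DefPred` allows all of `M`. A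
-- single formula has finitely many free variables, so only those are kept. The spare last slot,
-- filled with `c`, makes the number of parameters positive, as the schemes require; irrelevant
-- variables are also given the value `c`.
open Classical in
theorem DefPred.exists_params {R : M → M → Prop} (hR : DefPred fun v : ℕ → M => R (v 0) (v 1))
    (c : M) : ∃ (n : ℕ) (φ : lang.Formula (Fin (n + 1) ⊕ Fin 2)) (p : Fin (n + 1) → M),
      ∀ x y, φ.Realize (Sum.elim p ![x, y]) ↔ R x y := by
  obtain ⟨φ, hφ⟩ := hR
  let e := (Fintype.equivFin φ.freeVarFinset)
  let q : M ⊕ ℕ → M := Sum.elim id fun _ => c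
  let f : φ.freeVarFinset → Fin (Fintype.card φ.freeVarFinset + 1) ⊕ Fin 2 := fun i =>
    if (i : M ⊕ ℕ) = .inr 0 then .inr 0 else if (i : M ⊕ ℕ) = .inr 1 then .inr 1 else
      .inl (e i).castSucc
  let p : Fin (Fintype.card φ.freeVarFinset + 1) → M := Fin.snoc (fun i => q (e.symm i)) c
  refine ⟨_, φ.restrictFreeVar f, p, fun x y => ?_⟩
  rw [← show φ.Realize (Sum.elim id fun i => if i = 0 then x else if i = 1 then y else c) ↔ R x y
    from hφ _]
  refine FirstOrder.Language.BoundedFormula.realize_restrictFreeVar _ fun i => ?_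
  obtain ⟨i | i, hi⟩ := i
  · simp [f, p, q]
  · by_cases h0 : i = 0
    · subst h0; simp [f]
    · by_cases h1 : i = 1
      · subst h1; simp [f]
      · simp [f, p, q, h0, h1]

end Definability

/-! ## Basic set theory in a model -/

section Sets

universe u
variable {M : Type u} [lang.Structure M]

variable (M) in
/-- `M` is a non-empty model of ZFG[0]. -/
class IsModel : Prop where
  nonempty : Nonempty M
  model : IsZFGModel M

attribute [instance] IsModel.nonempty

variable [IsModel M]

theorem mem_ext {a b : M} (h : ∀ x, Mem x a ↔ Mem x b) : a = b :=
  IsModel.model.extensionality a b h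

theorem exists_replacement (a : M) (R : M → M → Prop) [hR : DefPred fun v : ℕ → M => R (v 0) (v 1)]
    (h : ∀ x, Mem x a → ∀ y z, R x y → R x z → y = z) :
    ∃ b, ∀ y, Mem y b ↔ ∃ x, Mem x a ∧ R x y := by
  obtain ⟨n, φ, p, hφ⟩ := hR.exists_params a
  simpa only [hφ] using IsModel.model.replacement n φ p a (by simpa only [hφ] using h)

/-- Replacement is assumed for partial functions, so separation is its instance for the identity
restricted to `Q`. -/
theorem exists_sep (a : M) (Q : M → Prop) [hQ : DefPred fun v : ℕ → M => Q (v 0)] :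
    ∃ b, ∀ x, Mem x b ↔ Mem x a ∧ Q x := by
  obtain ⟨b, hb⟩ := exists_replacement a (fun x y => Q x ∧ y = x)
    (by rintro x - y z ⟨-, rfl⟩ ⟨-, rfl⟩; rfl)
  refine ⟨b, fun x => (hb x).trans ⟨?_, fun h => ⟨x, h.1, h.2, rfl⟩⟩⟩
  rintro ⟨y, hy, hQ, rfl⟩
  exact ⟨hy, hQ⟩

theorem exists_image (a : M) (t : M → M) [DefFun fun v : ℕ → M => t (v 0)] :
    ∃ b, ∀ y, Mem y b ↔ ∃ x, Mem x a ∧ y = t x :=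
  exists_replacement a (fun x y => y = t x) (by rintro x - y z rfl rfl; rfl)

theorem exists_iUnion (a : M) (t : M → M) [DefFun fun v : ℕ → M => t (v 0)] :
    ∃ b, ∀ y, Mem y b ↔ ∃ x, Mem x a ∧ Mem y (t x) := by
  obtain ⟨c, hc⟩ := exists_image a t
  obtain ⟨b, hb⟩ := IsModel.model.union c
  refine ⟨b, fun y => (hb y).trans ?_⟩
  constructor
  · rintro ⟨z, hz, hy⟩
    obtain ⟨x, hx, rfl⟩ := (hc z).1 hz
    exact ⟨x, hx, hy⟩
  · rintro ⟨x, hx, hy⟩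
    exact ⟨t x, (hc _).2 ⟨x, hx, rfl⟩, hy⟩

/-- Foundation is applied to `{a}`. The fact is needed for natural numbers, where it makes `n` a new
element of `n ∪ {n}`. -/
theorem not_mem_self (a : M) : ¬ Mem a a := by
  intro h
  obtain ⟨b, hb⟩ := IsModel.model.pairing a a
  obtain ⟨x, hx, hx'⟩ := IsModel.model.foundation b ⟨a, (hb a).2 (.inl rfl)⟩
  obtain rfl : x = a := by simpa using (hb x).1 hx
  exact hx' x hx h

/-- By extensionality a set is determined by its membership condition. This is how the relational
definitions, such as `IsProduct P A B`, become equations with definable functions, such as `P = cart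
A B`. -/
theorem exists_eq_iff_of_mem_iff {Q : M → Prop} (h : ∃ c, ∀ z, Mem z c ↔ Q z) (d : M) :
    (∀ z, Mem z d ↔ Q z) ↔ d = the fun c => ∀ z, Mem z c ↔ Q z := by
  obtain ⟨c, hc⟩ := h
  have : ∀ d, (∀ z, Mem z d ↔ Q z) ↔ d = c := fun d =>
    ⟨fun hd => mem_ext fun z => (hd z).trans (hc z).symm, fun e => e ▸ hc⟩
  rw [the_eq this, this]

/-! ### Pairs -/

/-- The unordered pair. -/
noncomputable def upair (a b : M) : M := the fun c => IsUpair c a b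

theorem isUpair_iff {c a b : M} : IsUpair c a b ↔ c = upair a b :=
  exists_eq_iff_of_mem_iff (IsModel.model.pairing a b) c

@[simp] theorem mem_upair {z a b : M} : Mem z (upair a b) ↔ z = a ∨ z = b :=
  isUpair_iff.2 rfl z

theorem upair_inj {a b c d : M} (h : upair a b = upair c d) :
    a = c ∧ b = d ∨ a = d ∧ b = c := by
  have h1 := (mem_upair (z := a)).1 (h ▸ mem_upair.2 (.inl rfl))
  have h2 := (mem_upair (z := b)).1 (h ▸ mem_upair.2 (.inr rfl))
  have h3 := (mem_upair (z := c)).1 (h.symm ▸ mem_upair.2 (.inl rfl))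
  have h4 := (mem_upair (z := d)).1 (h.symm ▸ mem_upair.2 (.inr rfl))
  grind

/-- The ordered pair. -/
noncomputable def pair (a b : M) : M := upair (upair a a) (upair a b)

theorem isOpair_iff {p a b : M} : IsOpair p a b ↔ p = pair a b := by
  simp [IsOpair, isUpair_iff, pair]

@[simp] theorem pair_inj {a b c d : M} : pair a b = pair c d ↔ a = c ∧ b = d := by
  refine ⟨fun h => ?_, fun h => h.1 ▸ h.2 ▸ rfl⟩
  rcases upair_inj h with ⟨h1, h2⟩ | ⟨h1, h2⟩ <;>
  · have h1 := upair_inj h1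
    have h2 := upair_inj h2
    grind

/-- The first component of an ordered pair. -/
noncomputable def fst (p : M) : M := the fun a => ∃ b, p = pair a b
/-- The second component of an ordered pair. -/
noncomputable def snd (p : M) : M := the fun b => ∃ a, p = pair a b

@[simp] theorem fst_pair (a b : M) : fst (pair a b) = a := the_eq fun z => by simp [eq_comm]
@[simp] theorem snd_pair (a b : M) : snd (pair a b) = b := the_eq fun z => by simp [eq_comm]

theorem isTriple_iff {t a b c : M} : IsTriple t a b c ↔ t = pair a (pair b c) := by
  simp [IsTriple, isOpair_iff]

theorem app_iff_mem {f x y : M} : App f x y ↔ Mem (pair x y) f := by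
  simp [App, isOpair_iff]

instance {a b c : (ℕ → M) → M} [DefFun a] [DefFun b] [DefFun c] :
    DefPred fun v => IsUpair (a v) (b v) (c v) := by unfold IsUpair; infer_instance
instance {a b : (ℕ → M) → M} [DefFun a] [DefFun b] :
    DefFun fun v => upair (a v) (b v) := by unfold upair; infer_instance
instance {a b : (ℕ → M) → M} [DefFun a] [DefFun b] :
    DefFun fun v => pair (a v) (b v) := by
  unfold pair; infer_instance
instance {a b c : (ℕ → M) → M} [DefFun a] [DefFun b] [DefFun c] :
    DefPred fun v => IsOpair (a v) (b v) (c v) := by unfold IsOpair; infer_instance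
instance {a : (ℕ → M) → M} [DefFun a] : DefFun fun v => fst (a v) := by
  unfold fst; infer_instance
instance {a : (ℕ → M) → M} [DefFun a] : DefFun fun v => snd (a v) := by
  unfold snd; infer_instance
instance {a b c : (ℕ → M) → M} [DefFun a] [DefFun b] [DefFun c] :
    DefPred fun v => App (a v) (b v) (c v) := by unfold App; infer_instance

/-! ### The empty set, adding and removing elements -/

theorem exists_isEmpty : ∃ e : M, IsEmpty e := by
  obtain ⟨w, ⟨e, -, he⟩, -⟩ := IsModel.model (M := M).infinity
  exact ⟨e, he⟩

/-- The empty set. -/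
noncomputable def emp : M := the fun e => IsEmpty e

theorem isEmpty_iff {e : M} : IsEmpty e ↔ e = emp := by
  simpa [IsEmpty, emp] using exists_eq_iff_of_mem_iff (Q := fun _ : M => False)
    (by simpa [IsEmpty] using exists_isEmpty) e

@[simp] theorem not_mem_emp {x : M} : ¬ Mem x emp := isEmpty_iff.2 rfl x

theorem eq_emp {a : M} (h : ∀ x, ¬ Mem x a) : a = emp := isEmpty_iff.1 h

/-- `s ∪ {p}`. -/
noncomputable def ins (s p : M) : M := the fun u => IsInsert u s p

theorem isInsert_iff {u s p : M} : IsInsert u s p ↔ u = ins s p := by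
  refine exists_eq_iff_of_mem_iff ?_ u
  obtain ⟨c, hc⟩ := IsModel.model.union (upair s (upair p p))
  exact ⟨c, fun z => by simp [hc]⟩

@[simp] theorem mem_ins {z s p : M} : Mem z (ins s p) ↔ Mem z s ∨ z = p :=
  isInsert_iff.2 rfl z

/-- `s \ {p}`. -/
noncomputable def del (s p : M) : M := the fun u => ∀ z, Mem z u ↔ Mem z s ∧ z ≠ p

@[simp] theorem mem_del {z s p : M} : Mem z (del s p) ↔ Mem z s ∧ z ≠ p := by
  refine (exists_eq_iff_of_mem_iff ?_ _).2 rfl z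
  have : DefPred fun v : ℕ → M => v 0 ≠ p := inferInstanceAs (DefPred fun v : ℕ → M => ¬ v 0 = p)
  exact exists_sep s fun z => z ≠ p

theorem ins_eq_self {s p : M} (h : Mem p s) : ins s p = s :=
  mem_ext fun z => by simp only [mem_ins]; grind

theorem ins_del {s p : M} (h : Mem p s) : ins (del s p) p = s :=
  mem_ext fun z => by simp only [mem_ins, mem_del]; grind

theorem del_ins {s p : M} (h : ¬ Mem p s) : del (ins s p) p = s :=
  mem_ext fun z => by simp only [mem_ins, mem_del]; grind

theorem del_ins_of_ne {s p q : M} (h : p ≠ q) : del (ins s p) q = ins (del s q) p :=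
  mem_ext fun z => by simp only [mem_ins, mem_del]; grind

instance {a : (ℕ → M) → M} [DefFun a] : DefPred fun v => IsEmpty (a v) := by
  unfold IsEmpty; infer_instance
instance {a b c : (ℕ → M) → M} [DefFun a] [DefFun b] [DefFun c] :
    DefPred fun v => IsInsert (a v) (b v) (c v) := by unfold IsInsert; infer_instance
instance {a b : (ℕ → M) → M} [DefFun a] [DefFun b] : DefFun fun v => ins (a v) (b v) := by
  unfold ins; infer_instance

/-! ### Products -/

/-- Instead of being separated from an iterated power set, the product is the union over `x ∈ A` of
the slices `{x} × B`, each an image of `B`. Writing the slice with `the` makes it a definable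
function of `x`. -/
theorem exists_isProduct (A B : M) : ∃ P, IsProduct P A B := by
  have h (x : M) : ∃ c, ∀ z, Mem z c ↔ ∃ y, Mem y B ∧ z = pair x y :=
    exists_image B fun y => pair x y
  obtain ⟨P, hP⟩ := exists_iUnion A fun x => the fun c => ∀ z, Mem z c ↔ ∃ y, Mem y B ∧ z = pair x y
  refine ⟨P, fun p => (hP p).trans ?_⟩
  simp only [(exists_eq_iff_of_mem_iff (h _) _).2 rfl p, isOpair_iff]

/-- The product `A × B`. -/
noncomputable def cart (A B : M) : M := the fun P => IsProduct P A B

theorem isProduct_iff {P A B : M} : IsProduct P A B ↔ P = cart A B :=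
  exists_eq_iff_of_mem_iff (exists_isProduct A B) P

theorem mem_cart {p A B : M} : Mem p (cart A B) ↔ ∃ x, Mem x A ∧ ∃ y, Mem y B ∧ p = pair x y := by
  simpa only [isOpair_iff] using isProduct_iff.2 rfl p

@[simp] theorem pair_mem_cart {x y A B : M} : Mem (pair x y) (cart A B) ↔ Mem x A ∧ Mem y B := by
  rw [mem_cart]
  constructor
  · rintro ⟨x', hx, y', hy, h⟩
    obtain ⟨rfl, rfl⟩ := pair_inj.1 h
    exact ⟨hx, hy⟩
  · rintro ⟨hx, hy⟩
    exact ⟨x, hx, y, hy, rfl⟩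

instance {a b c : (ℕ → M) → M} [DefFun a] [DefFun b] [DefFun c] :
    DefPred fun v => IsProduct (a v) (b v) (c v) := by unfold IsProduct; infer_instance
instance {a b : (ℕ → M) → M} [DefFun a] [DefFun b] : DefFun fun v => cart (a v) (b v) := by
  unfold cart; infer_instance

/-! ### Functions -/

/-- The value `f x`. -/
noncomputable def ap (f x : M) : M := the fun y => App f x y

/-- Off the domain `ap f x` is a meaningless default, so membership in the domain has to be recorded
beside the equation. -/
theorem IsFunc.app_iff {f A B x y : M} (hf : IsFunc f A B) :
    App f x y ↔ Mem x A ∧ y = ap f x := by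
  have key (hx : Mem x A) : App f x y ↔ y = ap f x := by
    obtain ⟨z, hz⟩ := hf.2 x hx
    rw [ap, the_eq hz, hz]
  refine ⟨fun h => ?_, fun h => (key h.1).2 h.2⟩
  have hx : Mem x A := by
    obtain ⟨p, hp, hxy⟩ := h
    obtain ⟨x', hx', y', hy', h'⟩ := hf.1 p hp
    rw [isOpair_iff] at hxy h'
    obtain ⟨rfl, rfl⟩ := pair_inj.1 (hxy.symm.trans h')
    exact hx'
  exact ⟨hx, (key hx).1 h⟩

theorem IsFunc.mem_iff {f A B p : M} (hf : IsFunc f A B) :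
    Mem p f ↔ ∃ x, Mem x A ∧ p = pair x (ap f x) := by
  constructor
  · intro hp
    obtain ⟨x, hx, y, hy, h⟩ := hf.1 p hp
    rw [isOpair_iff] at h
    subst h
    exact ⟨x, hx, by rw [(hf.app_iff.1 (app_iff_mem.2 hp)).2]⟩
  · rintro ⟨x, hx, rfl⟩
    exact app_iff_mem.1 (hf.app_iff.2 ⟨hx, rfl⟩)

theorem IsFunc.ap_mem {f A B x : M} (hf : IsFunc f A B) (hx : Mem x A) : Mem (ap f x) B := by
  obtain ⟨p, hp, hxy⟩ := hf.app_iff.2 ⟨hx, rfl⟩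
  obtain ⟨x', hx', y', hy', h'⟩ := hf.1 p hp
  rw [isOpair_iff] at hxy h'
  rw [(pair_inj.1 (hxy.symm.trans h')).2]
  exact hy'

theorem IsFunc.ext {f g A B B' : M} (hf : IsFunc f A B) (hg : IsFunc g A B')
    (h : ∀ x, Mem x A → ap f x = ap g x) : f = g := by
  refine mem_ext fun p => ?_
  rw [hf.mem_iff, hg.mem_iff]
  refine exists_congr fun x => and_congr_right fun hx => ?_
  rw [h x hx]

theorem isFunc_of_mem_iff {f A B : M} {t : M → M} (ht : ∀ x, Mem x A → Mem (t x) B)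
    (hf : ∀ p, Mem p f ↔ ∃ x, Mem x A ∧ p = pair x (t x)) :
    IsFunc f A B ∧ ∀ x, Mem x A → ap f x = t x := by
  have key (x : M) (hx : Mem x A) (y : M) : App f x y ↔ y = t x := by
    rw [app_iff_mem, hf]
    constructor
    · rintro ⟨x', -, h⟩
      obtain ⟨rfl, rfl⟩ := pair_inj.1 h
      rfl
    · rintro rfl
      exact ⟨x, hx, rfl⟩
  refine ⟨⟨fun p hp => ?_, fun x hx => ⟨t x, key x hx⟩⟩, fun x hx => the_eq (key x hx)⟩
  obtain ⟨x, hx, rfl⟩ := (hf p).1 hp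
  exact ⟨x, hx, t x, ht x hx, isOpair_iff.2 rfl⟩

theorem exists_isFunc {A B : M} (t : M → M) [DefFun fun v : ℕ → M => t (v 0)]
    (ht : ∀ x, Mem x A → Mem (t x) B) :
    ∃ f, IsFunc f A B ∧ ∀ x, Mem x A → ap f x = t x := by
  obtain ⟨f, hf⟩ := exists_image A fun x => pair x (t x)
  exact ⟨f, isFunc_of_mem_iff ht hf⟩

instance {a b c : (ℕ → M) → M} [DefFun a] [DefFun b] [DefFun c] :
    DefPred fun v => IsFunc (a v) (b v) (c v) := by unfold IsFunc; infer_instance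
instance {a b : (ℕ → M) → M} [DefFun a] [DefFun b] : DefFun fun v => ap (a v) (b v) := by
  unfold ap; infer_instance

end Sets

/-! ## Natural numbers and finite sets in a model -/

section Finite

universe u
variable {M : Type u} [lang.Structure M] [IsModel M]

theorem isInductiveSet_iff {w : M} :
    IsInductiveSet w ↔ Mem emp w ∧ ∀ x, Mem x w → Mem (ins x x) w := by
  simp [IsInductiveSet, isEmpty_iff, isInsert_iff]

instance {a : (ℕ → M) → M} [DefFun a] : DefPred fun v => IsInductiveSet (a v) := by
  unfold IsInductiveSet; infer_instance
instance {a : (ℕ → M) → M} [DefFun a] : DefPred fun v => IsNatural (a v) := by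
  unfold IsNatural; infer_instance
instance {a b c : (ℕ → M) → M} [DefFun a] [DefFun b] [DefFun c] :
    DefPred fun v => IsBijection (a v) (b v) (c v) := by unfold IsBijection; infer_instance

theorem isNatural_emp : IsNatural (emp : M) := fun _ hw => (isInductiveSet_iff.1 hw).1

theorem IsNatural.succ {n : M} (hn : IsNatural n) : IsNatural (ins n n) :=
  fun w hw => (isInductiveSet_iff.1 hw).2 n (hn w hw)

theorem exists_isInductiveSet : ∃ w : M, IsInductiveSet w := by
  obtain ⟨w, ⟨e, he, he'⟩, hw⟩ := IsModel.model (M := M).infinity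
  exact ⟨w, ⟨e, he, he'⟩, hw⟩

theorem exists_naturals : ∃ w : M, ∀ n, Mem n w ↔ IsNatural n := by
  obtain ⟨w, hw⟩ := exists_isInductiveSet (M := M)
  obtain ⟨w', hw'⟩ := exists_sep w fun n => IsNatural n
  exact ⟨w', fun n => (hw' n).trans ⟨And.right, fun h => ⟨h w hw, h⟩⟩⟩

/-- Natural numbers are those of the model and may be non-standard, so induction holds only for
definable `Q`: then the natural numbers satisfying `Q` form an inductive set of `M`. -/
theorem IsNatural.induction {Q : M → Prop} [hQ : DefPred fun v : ℕ → M => Q (v 0)] (h0 : Q emp)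
    (hs : ∀ n, IsNatural n → Q n → Q (ins n n)) {n : M} (hn : IsNatural n) : Q n := by
  obtain ⟨w, hw⟩ := exists_naturals (M := M)
  obtain ⟨w', hw'⟩ := exists_sep w Q
  refine ((hw' n).1 (hn w' (isInductiveSet_iff.2 ⟨?_, fun x hx => ?_⟩))).2
  · exact (hw' _).2 ⟨(hw _).2 isNatural_emp, h0⟩
  · obtain ⟨hx, hQx⟩ := (hw' x).1 hx
    have hx := (hw x).1 hx
    exact (hw' _).2 ⟨(hw _).2 hx.succ, hs x hx hQx⟩

/-! ### Sets of a given finite size -/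

theorem exists_isBijection_emp_iff {s : M} : (∃ f, IsBijection f emp s) ↔ s = emp := by
  constructor
  · rintro ⟨f, hf, h⟩
    refine eq_emp fun y hy => ?_
    obtain ⟨x, hx⟩ := h y hy
    exact not_mem_emp (hf.app_iff.1 ((hx x).2 rfl)).1
  · rintro rfl
    refine ⟨emp, ⟨fun p hp => (not_mem_emp hp).elim, fun p hp => (not_mem_emp hp).elim⟩,
      fun p hp => (not_mem_emp hp).elim⟩

theorem IsBijection.app_iff {f A B x y : M} (hf : IsBijection f A B) :
    App f x y ↔ Mem x A ∧ y = ap f x := hf.1.app_iff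

theorem IsBijection.injective {f A B x y : M} (hf : IsBijection f A B) (hx : Mem x A) (hy : Mem y A)
    (h : ap f x = ap f y) : x = y := by
  obtain ⟨z, hz⟩ := hf.2 (ap f x) (hf.1.ap_mem hx)
  rw [(hz x).1 (hf.app_iff.2 ⟨hx, rfl⟩), (hz y).1 (hf.app_iff.2 ⟨hy, h⟩)]

theorem IsBijection.surjective {f A B y : M} (hf : IsBijection f A B) (hy : Mem y B) :
    ∃ x, Mem x A ∧ ap f x = y := by
  obtain ⟨x, hx⟩ := hf.2 y hy
  have := hf.app_iff.1 ((hx x).2 rfl)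
  exact ⟨x, this.1, this.2.symm⟩

theorem IsFunc.isBijection {f A B : M} (hf : IsFunc f A B)
    (hi : ∀ x y, Mem x A → Mem y A → ap f x = ap f y → x = y)
    (hs : ∀ y, Mem y B → ∃ x, Mem x A ∧ ap f x = y) : IsBijection f A B := by
  refine ⟨hf, fun y hy => ?_⟩
  obtain ⟨x, hx, rfl⟩ := hs y hy
  refine ⟨x, fun x' => hf.app_iff.trans ⟨fun h => (hi _ _ hx h.1 h.2).symm, ?_⟩⟩
  rintro rfl
  exact ⟨hx, rfl⟩

/-- In one direction the image of the top element `n` is removed; in the other the bijection is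
extended by `n ↦ p`. This is the successor step of every induction on the size of a finite set. -/
theorem exists_isBijection_succ_iff {n s : M} : (∃ f, IsBijection f (ins n n) s) ↔
    ∃ t p, ¬ Mem p t ∧ (∃ f, IsBijection f n t) ∧ s = ins t p := by
  have hnn := not_mem_self n
  constructor
  · rintro ⟨f, hf⟩
    have hn : Mem n (ins n n) := mem_ins.2 (.inr rfl)
    have hp := hf.1.ap_mem hn
    refine ⟨del s (ap f n), ap f n, by simp, ?_, (ins_del hp).symm⟩
    obtain ⟨g, hg, hg'⟩ := exists_isFunc (A := n) (B := del s (ap f n)) (fun x => ap f x) (by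
      intro x hx
      have hx' : Mem x (ins n n) := mem_ins.2 (.inl hx)
      refine mem_del.2 ⟨hf.1.ap_mem hx', fun h => ?_⟩
      rw [hf.injective hx' hn h] at hx
      exact hnn hx)
    refine ⟨g, hg.isBijection (fun x y hx hy h => ?_) fun y hy => ?_⟩
    · rw [hg' x hx, hg' y hy] at h
      exact hf.injective (mem_ins.2 (.inl hx)) (mem_ins.2 (.inl hy)) h
    · obtain ⟨hy, hne⟩ := mem_del.1 hy
      obtain ⟨x, hx, rfl⟩ := hf.surjective hy
      rcases mem_ins.1 hx with hx | rfl
      · exact ⟨x, hx, hg' x hx⟩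
      · exact (hne rfl).elim
  · rintro ⟨t, p, hp, ⟨f, hf⟩, rfl⟩
    -- The definition by cases is a definite description; since `n ∉ n`, the two cases exclude each
    -- other.
    obtain ⟨g, hg, hg'⟩ := exists_isFunc (A := ins n n) (B := ins t p)
      (fun x => the fun y => Mem x n ∧ y = ap f x ∨ x = n ∧ y = p) (by
        intro x hx
        rcases mem_ins.1 hx with hx | rfl
        · have hne : x ≠ n := by rintro rfl; exact hnn hx
          rw [the_eq (y := ap f x) (by simp [hx, hne])]
          exact mem_ins.2 (.inl (hf.1.ap_mem hx))
        · rw [the_eq (y := p) (by simp [hnn])]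
          exact mem_ins.2 (.inr rfl))
    have hgx (x : M) (hx : Mem x n) : ap g x = ap f x := by
      have hne : x ≠ n := by rintro rfl; exact hnn hx
      rw [hg' x (mem_ins.2 (.inl hx)), the_eq (y := ap f x) (by simp [hx, hne])]
    have hgn : ap g n = p := by
      rw [hg' n (mem_ins.2 (.inr rfl)), the_eq (y := p) (by simp [hnn])]
    refine ⟨g, hg.isBijection (fun x y hx hy h => ?_) fun y hy => ?_⟩
    · rcases mem_ins.1 hx with hx | rfl <;> rcases mem_ins.1 hy with hy | rfl
      · rw [hgx x hx, hgx y hy] at h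
        exact hf.injective hx hy h
      · rw [hgx x hx, hgn] at h
        exact (hp (h ▸ hf.1.ap_mem hx)).elim
      · rw [hgn, hgx y hy] at h
        exact (hp (h ▸ hf.1.ap_mem hy)).elim
      · rfl
    · rcases mem_ins.1 hy with hy | rfl
      · obtain ⟨x, hx, rfl⟩ := hf.surjective hy
        exact ⟨x, mem_ins.2 (.inl hx), hgx x hx⟩
      · exact ⟨n, mem_ins.2 (.inr rfl), hgn⟩

theorem isFinite_emp : IsFinite (emp : M) := by
  obtain ⟨f, hf⟩ := exists_isBijection_emp_iff.2 (rfl : (emp : M) = emp)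
  exact ⟨emp, f, isNatural_emp, hf⟩

theorem IsFinite.ins {s : M} (hs : IsFinite s) (p : M) : IsFinite (ins s p) := by
  by_cases hp : Mem p s
  · rwa [ins_eq_self hp]
  · obtain ⟨n, f, hn, hf⟩ := hs
    obtain ⟨g, hg⟩ := exists_isBijection_succ_iff.2 ⟨s, p, hp, ⟨f, hf⟩, rfl⟩
    exact ⟨_, g, hn.succ, hg⟩

theorem IsFinite.induction {Q : M → Prop} [hQ : DefPred fun v : ℕ → M => Q (v 0)] (h0 : Q emp)
    (hs : ∀ s p, IsFinite s → ¬ Mem p s → Q s → Q (ZFG.ins s p)) {s : M} (h : IsFinite s) :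
    Q s := by
  obtain ⟨n, f, hn, hf⟩ := h
  have : DefPred fun w : ℕ → M => Q (w 0) := hQ
  -- The induction is on the size, for all sets of that size at once, because the step passes to a
  -- smaller set.
  refine hn.induction (Q := fun n => ∀ s, (∃ f, IsBijection f n s) → Q s) ?_ ?_ s ⟨f, hf⟩
  · intro s hs
    rwa [exists_isBijection_emp_iff.1 hs]
  · intro n hn ih s hs'
    obtain ⟨t, p, hp, ⟨f, hf⟩, rfl⟩ := exists_isBijection_succ_iff.1 hs'
    exact hs t p ⟨n, f, hn, hf⟩ hp (ih t ⟨f, hf⟩)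

/-- This replaces the power set axiom. The subsets of size `n + 1` are the image, under `⟨t, p⟩ ↦ t
∪ {p}`, of those pairs in `S × P` with `p ∉ t`, where `S` is the set of subsets of size `n`. -/
theorem exists_subsets_of_card (P : M) {n : M} (hn : IsNatural n) :
    ∃ S, ∀ s, Mem s S ↔ (∀ z, Mem z s → Mem z P) ∧ ∃ f, IsBijection f n s := by
  refine hn.induction (Q := fun n => ∃ S, ∀ s, Mem s S ↔
    (∀ z, Mem z s → Mem z P) ∧ ∃ f, IsBijection f n s) ?_ ?_
  · refine ⟨upair emp emp, fun s => ?_⟩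
    rw [exists_isBijection_emp_iff, mem_upair, or_self]
    exact ⟨by rintro rfl; simp, And.right⟩
  · rintro n hn ⟨S, hS⟩
    obtain ⟨A, hA⟩ := exists_sep (cart S P) fun z => ¬ Mem (snd z) (fst z)
    obtain ⟨B, hB⟩ := exists_image A fun z => ins (fst z) (snd z)
    refine ⟨B, fun s => ?_⟩
    rw [hB, exists_isBijection_succ_iff]
    constructor
    · rintro ⟨z, hz, rfl⟩
      obtain ⟨hz, hm⟩ := (hA z).1 hz
      obtain ⟨t, ht, p, hp, rfl⟩ := mem_cart.1 hz
      simp only [fst_pair, snd_pair] at hm ⊢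
      refine ⟨fun z hz => ?_, t, p, hm, ((hS t).1 ht).2, rfl⟩
      rcases mem_ins.1 hz with hz | rfl
      · exact ((hS t).1 ht).1 z hz
      · exact hp
    · rintro ⟨hsub, t, p, hp, hf, rfl⟩
      refine ⟨pair t p, (hA _).2 ⟨pair_mem_cart.2 ⟨(hS t).2 ⟨fun z hz => ?_, hf⟩, ?_⟩, ?_⟩, ?_⟩
      · exact hsub z (mem_ins.2 (.inl hz))
      · exact hsub p (mem_ins.2 (.inr rfl))
      · simpa
      · simp

theorem exists_isFinSubsets (P : M) : ∃ S, IsFinSubsets S P := by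
  obtain ⟨w, hw⟩ := exists_naturals (M := M)
  -- By extensionality the set of subsets of size `n` is a definable function of `n`, so replacement
  -- and union over the set of natural numbers apply.
  obtain ⟨S, hS⟩ := exists_iUnion w fun n => the fun S => ∀ s, Mem s S ↔
    (∀ z, Mem z s → Mem z P) ∧ ∃ f, IsBijection f n s
  refine ⟨S, fun s => (hS s).trans ?_⟩
  constructor
  · rintro ⟨n, hn, hs⟩
    have hn := (hw n).1 hn
    obtain ⟨h, f, hf⟩ :=
      ((exists_eq_iff_of_mem_iff (exists_subsets_of_card P hn) _).2 rfl s).1 hs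
    exact ⟨h, n, f, hn, hf⟩
  · rintro ⟨h, n, f, hn, hf⟩
    exact ⟨n, (hw n).2 hn,
      ((exists_eq_iff_of_mem_iff (exists_subsets_of_card P hn) _).2 rfl s).2 ⟨h, f, hf⟩⟩

/-! ### Closure properties of, and induction over, the set of finite subsets -/

section FinSubsets

variable {S P : M} (hS : IsFinSubsets S P)
include hS

theorem IsFinSubsets.emp_mem : Mem emp S := (hS _).2 ⟨by simp, isFinite_emp⟩

theorem IsFinSubsets.ins_mem {s p : M} (hs : Mem s S) (hp : Mem p P) : Mem (ins s p) S := by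
  obtain ⟨h, hf⟩ := (hS s).1 hs
  refine (hS _).2 ⟨fun z hz => ?_, hf.ins p⟩
  rcases mem_ins.1 hz with hz | rfl
  exacts [h z hz, hp]

theorem IsFinSubsets.induction {Q : M → Prop} [hQ : DefPred fun v : ℕ → M => Q (v 0)] (h0 : Q emp)
    (hs : ∀ s p, Mem s S → Mem p P → ¬ Mem p s → Q s → Q (ins s p)) {s : M} (h : Mem s S) :
    Q s := by
  have : DefPred fun w : ℕ → M => Q (w 0) := hQ
  refine ((hS s).1 h).2.induction (Q := fun s => Mem s S → Q s) (fun _ => h0) ?_ h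
  intro s p hf hp ih hsp
  have hsub := ((hS _).1 hsp).1
  have hs' : Mem s S := (hS s).2 ⟨fun z hz => hsub z (mem_ins.2 (.inl hz)), hf⟩
  exact hs s p hs' (hsub p (mem_ins.2 (.inr rfl))) hp (ih hs')

theorem IsFinSubsets.del_mem {s : M} (hs : Mem s S) (p : M) : Mem (del s p) S := by
  refine hS.induction (Q := fun s => ∃ t, Mem t S ∧ ∀ z, Mem z t ↔ Mem z s ∧ ¬ z = p) ?_ ?_ hs
    |>.elim fun t ht => ?_
  · exact ⟨emp, hS.emp_mem, by simp⟩
  · rintro s q hs hq - ⟨t, ht, h⟩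
    by_cases hqp : q = p
    · exact ⟨t, ht, fun z => by rw [h, mem_ins]; grind⟩
    · exact ⟨ins t q, hS.ins_mem ht hq, fun z => by rw [mem_ins, h, mem_ins]; grind⟩
  · have : del s p = t := mem_ext fun z => by rw [mem_del, ht.2]
    exact this ▸ ht.1

end FinSubsets

end Finite

/-! ## Algebra in a model -/

section Algebra

universe u
variable {M : Type u} [lang.Structure M]

section Projections

variable {R a m N b s : M}

theorem IsCommRing.add (hR : IsCommRing R a m) : IsAbGroup R a := hR.1
theorem IsCommRing.mul (hR : IsCommRing R a m) : IsOp m R R R := hR.2.1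
theorem IsCommRing.exists_one (hR : IsCommRing R a m) : ∃ e, IsLeftUnit R m e := hR.2.2.2.2.1

theorem IsModule.add (hN : IsModule R a m N b s) : IsAbGroup N b := hN.1
theorem IsModule.smul (hN : IsModule R a m N b s) : IsOp s R N N := hN.2.1

end Projections

variable [IsModel M]

instance {t u : (ℕ → M) → M} [DefFun t] [DefFun u] : DefPred fun v => t v ≠ u v :=
  inferInstanceAs (DefPred fun v => ¬ t v = u v)
instance {a b : (ℕ → M) → M} [DefFun a] [DefFun b] : DefFun fun v => del (a v) (b v) := by
  unfold del; infer_instance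

/-- The value `f ⟨x, y⟩`. -/
noncomputable def ap₂ (f x y : M) : M := ap f (pair x y)

instance {a b c : (ℕ → M) → M} [DefFun a] [DefFun b] [DefFun c] :
    DefFun fun v => ap₂ (a v) (b v) (c v) := by unfold ap₂; infer_instance
instance {a b c d : (ℕ → M) → M} [DefFun a] [DefFun b] [DefFun c] [DefFun d] :
    DefPred fun v => App₂ (a v) (b v) (c v) (d v) := by unfold App₂; infer_instance
instance {a b c d : (ℕ → M) → M} [DefFun a] [DefFun b] [DefFun c] [DefFun d] :
    DefPred fun v => IsOp (a v) (b v) (c v) (d v) := by unfold IsOp; infer_instance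
instance {a b c : (ℕ → M) → M} [DefFun a] [DefFun b] [DefFun c] :
    DefPred fun v => IsLeftUnit (a v) (b v) (c v) := by unfold IsLeftUnit; infer_instance
instance {a b : (ℕ → M) → M} [DefFun a] [DefFun b] :
    DefPred fun v => IsAssoc (a v) (b v) := by unfold IsAssoc; infer_instance
instance {a b : (ℕ → M) → M} [DefFun a] [DefFun b] :
    DefPred fun v => IsComm (a v) (b v) := by unfold IsComm; infer_instance
instance {a b : (ℕ → M) → M} [DefFun a] [DefFun b] :
    DefPred fun v => IsAbGroup (a v) (b v) := by unfold IsAbGroup; infer_instance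
set_option synthInstance.maxSize 1000 in
set_option synthInstance.maxHeartbeats 200000 in
instance {R a m N b s : (ℕ → M) → M} [DefFun R] [DefFun a] [DefFun m] [DefFun N] [DefFun b]
    [DefFun s] : DefPred fun v => IsModule (R v) (a v) (m v) (N v) (b v) (s v) := by
  unfold IsModule; infer_instance
instance {R N b s N' b' s' f : (ℕ → M) → M} [DefFun R] [DefFun N] [DefFun b]
    [DefFun s] [DefFun N'] [DefFun b'] [DefFun s'] [DefFun f] :
    DefPred fun v => IsLinear (R v) (N v) (b v) (s v) (N' v) (b' v) (s' v) (f v) := by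
  unfold IsLinear; infer_instance
instance {F i N b s : (ℕ → M) → M} [DefFun F] [DefFun i] [DefFun N] [DefFun b]
    [DefFun s] : DefPred fun v => FamAt (F v) (i v) (N v) (b v) (s v) := by
  unfold FamAt IsTriple; infer_instance
instance {R I F N b s g : (ℕ → M) → M} [DefFun R] [DefFun I] [DefFun F] [DefFun N] [DefFun b]
    [DefFun s] [DefFun g] :
    DefPred fun v => IsCocone (R v) (I v) (F v) (N v) (b v) (s v) (g v) := by
  unfold IsCocone; infer_instance

/-! ### Operations -/

theorem isOp_iff {f A B C : M} : IsOp f A B C ↔ IsFunc f (cart A B) C := by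
  simp [IsOp, isProduct_iff]

theorem IsOp.app₂_iff {f A B C x y z : M} (hf : IsOp f A B C) :
    App₂ f x y z ↔ Mem x A ∧ Mem y B ∧ z = ap₂ f x y := by
  simp [App₂, isOpair_iff, (isOp_iff.1 hf).app_iff, ap₂, and_assoc]

theorem IsOp.mem {f A B C x y : M} (hf : IsOp f A B C) (hx : Mem x A) (hy : Mem y B) :
    Mem (ap₂ f x y) C :=
  (isOp_iff.1 hf).ap_mem (pair_mem_cart.2 ⟨hx, hy⟩)

theorem exists_isOp {A B C : M} (t : M → M → M) [DefFun fun v : ℕ → M => t (fst (v 0)) (snd (v 0))]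
    (ht : ∀ x y, Mem x A → Mem y B → Mem (t x y) C) :
    ∃ f, IsOp f A B C ∧ ∀ x y, Mem x A → Mem y B → ap₂ f x y = t x y := by
  obtain ⟨f, hf, h⟩ := exists_isFunc (A := cart A B) (B := C) (fun p => t (fst p) (snd p)) (by
    intro p hp
    obtain ⟨x, hx, y, hy, rfl⟩ := mem_cart.1 hp
    simpa using ht x y hx hy)
  refine ⟨f, isOp_iff.2 hf, fun x y hx hy => ?_⟩
  simpa [ap₂] using h (pair x y) (pair_mem_cart.2 ⟨hx, hy⟩)

/-! ### Abelian groups -/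

theorem IsOp.isLeftUnit_iff {A f e : M} (hf : IsOp f A A A) :
    IsLeftUnit A f e ↔ Mem e A ∧ ∀ x, Mem x A → ap₂ f e x = x := by
  simp only [IsLeftUnit, hf.app₂_iff]
  grind

theorem IsOp.isAssoc_iff {A f : M} (hf : IsOp f A A A) : IsAssoc A f ↔
    ∀ x y z, Mem x A → Mem y A → Mem z A → ap₂ f (ap₂ f x y) z = ap₂ f x (ap₂ f y z) := by
  simp only [IsAssoc, hf.app₂_iff]
  constructor
  · intro h x y z hx hy hz
    exact (h x hx y hy z hz _ _ _ ⟨hx, hy, rfl⟩ ⟨hy, hz, rfl⟩ ⟨hf.mem hx hy, hz, rfl⟩).2.2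
  · rintro h x hx y hy z hz _ _ _ ⟨-, -, rfl⟩ ⟨-, -, rfl⟩ ⟨-, -, rfl⟩
    exact ⟨hx, hf.mem hy hz, h x y z hx hy hz⟩

theorem IsOp.isComm_iff {A f : M} (hf : IsOp f A A A) : IsComm A f ↔
    ∀ x y, Mem x A → Mem y A → ap₂ f x y = ap₂ f y x := by
  simp only [IsComm, hf.app₂_iff]
  constructor
  · intro h x y hx hy
    exact (h x hx y hy _ ⟨hx, hy, rfl⟩).2.2
  · rintro h x hx y hy _ ⟨-, -, rfl⟩
    exact ⟨hy, hx, h x y hx hy⟩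

theorem IsAbGroup.mem {A f x y : M} (h : IsAbGroup A f) (hx : Mem x A) (hy : Mem y A) :
    Mem (ap₂ f x y) A := h.1.mem hx hy

theorem IsAbGroup.assoc {A f x y z : M} (h : IsAbGroup A f) (hx : Mem x A) (hy : Mem y A)
    (hz : Mem z A) : ap₂ f (ap₂ f x y) z = ap₂ f x (ap₂ f y z) :=
  h.1.isAssoc_iff.1 h.2.1 x y z hx hy hz

theorem IsAbGroup.comm {A f x y : M} (h : IsAbGroup A f) (hx : Mem x A) (hy : Mem y A) :
    ap₂ f x y = ap₂ f y x :=
  h.1.isComm_iff.1 h.2.2.1 x y hx hy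

theorem IsAbGroup.left_comm {A f x y z : M} (h : IsAbGroup A f) (hx : Mem x A) (hy : Mem y A)
    (hz : Mem z A) : ap₂ f x (ap₂ f y z) = ap₂ f y (ap₂ f x z) := by
  rw [← h.assoc hx hy hz, h.comm hx hy, h.assoc hy hx hz]

theorem IsAbGroup.unit_add {A f o x : M} (h : IsAbGroup A f) (ho : IsLeftUnit A f o)
    (hx : Mem x A) : ap₂ f o x = x := (h.1.isLeftUnit_iff.1 ho).2 x hx

theorem IsAbGroup.unit_unique {A f o o' : M} (h : IsAbGroup A f) (ho : IsLeftUnit A f o)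
    (ho' : IsLeftUnit A f o') : o = o' := by
  rw [← h.unit_add ho' ho.1, h.comm ho'.1 ho.1, h.unit_add ho ho'.1]

/-- An inverse of `x` cancels one summand in `x + x = x`. This is the source of `r · 0 = 0`, of `0 ·
x = 0`, and of the fact that linear maps out of the coproduct preserve zero. -/
theorem IsAbGroup.isLeftUnit_of_add_self {A f x : M} (h : IsAbGroup A f) (hx : Mem x A)
    (hxx : ap₂ f x x = x) : IsLeftUnit A f x := by
  obtain ⟨o, ho, hneg⟩ := h.2.2.2
  obtain ⟨y, hy, hxy⟩ := hneg x hx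
  have hxy := (h.1.app₂_iff.1 hxy).2.2
  have : ap₂ f x (ap₂ f x y) = ap₂ f x y := by rw [← h.assoc hx hx hy, hxx]
  rw [← hxy, h.comm hx ho.1, h.unit_add ho hx] at this
  rwa [this]

theorem IsAbGroup.exists_add_eq {A f o x : M} (h : IsAbGroup A f) (ho : IsLeftUnit A f o)
    (hx : Mem x A) : ∃ y, Mem y A ∧ ap₂ f x y = o := by
  obtain ⟨o', ho', hneg⟩ := h.2.2.2
  obtain ⟨y, hy, hxy⟩ := hneg x hx
  exact ⟨y, hy, by rw [← (h.1.app₂_iff.1 hxy).2.2, h.unit_unique ho' ho]⟩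

theorem IsAbGroup.intro {A f o : M} (hf : IsOp f A A A)
    (assoc : ∀ x y z, Mem x A → Mem y A → Mem z A →
      ap₂ f (ap₂ f x y) z = ap₂ f x (ap₂ f y z))
    (comm : ∀ x y, Mem x A → Mem y A → ap₂ f x y = ap₂ f y x)
    (ho : Mem o A) (unit : ∀ x, Mem x A → ap₂ f o x = x)
    (neg : ∀ x, Mem x A → ∃ y, Mem y A ∧ ap₂ f x y = o) : IsAbGroup A f := by
  refine ⟨hf, hf.isAssoc_iff.2 assoc, hf.isComm_iff.2 comm, o,
    hf.isLeftUnit_iff.2 ⟨ho, unit⟩, fun x hx => ?_⟩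
  obtain ⟨y, hy, h⟩ := neg x hx
  exact ⟨y, hy, hf.app₂_iff.2 ⟨hx, hy, h.symm⟩⟩

/-! ### Modules and linear maps -/

section Modules

variable {R a m N b s : M}

theorem IsModule.smul_add (hN : IsModule R a m N b s) {r x y : M} (hr : Mem r R) (hx : Mem x N)
    (hy : Mem y N) : ap₂ s r (ap₂ b x y) = ap₂ b (ap₂ s r x) (ap₂ s r y) := by
  refine (hN.smul.app₂_iff.1 (hN.2.2.1 r hr x hx y hy _ _ _ _
    (hN.add.1.app₂_iff.2 ⟨hx, hy, rfl⟩) (hN.smul.app₂_iff.2 ⟨hr, hx, rfl⟩)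
    (hN.smul.app₂_iff.2 ⟨hr, hy, rfl⟩) (hN.add.1.app₂_iff.2 ⟨?_, ?_, rfl⟩))).2.2.symm
  exacts [hN.smul.mem hr hx, hN.smul.mem hr hy]

theorem IsModule.add_smul (hR : IsCommRing R a m) (hN : IsModule R a m N b s) {q r x : M}
    (hq : Mem q R) (hr : Mem r R) (hx : Mem x N) :
    ap₂ s (ap₂ a q r) x = ap₂ b (ap₂ s q x) (ap₂ s r x) := by
  refine (hN.smul.app₂_iff.1 (hN.2.2.2.1 q hq r hr x hx _ _ _ _
    (hR.add.1.app₂_iff.2 ⟨hq, hr, rfl⟩) (hN.smul.app₂_iff.2 ⟨hq, hx, rfl⟩)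
    (hN.smul.app₂_iff.2 ⟨hr, hx, rfl⟩) (hN.add.1.app₂_iff.2 ⟨?_, ?_, rfl⟩))).2.2.symm
  exacts [hN.smul.mem hq hx, hN.smul.mem hr hx]

theorem IsModule.mul_smul (hR : IsCommRing R a m) (hN : IsModule R a m N b s) {q r x : M}
    (hq : Mem q R) (hr : Mem r R) (hx : Mem x N) :
    ap₂ s (ap₂ m q r) x = ap₂ s q (ap₂ s r x) := by
  refine (hN.smul.app₂_iff.1 (hN.2.2.2.2.1 q hq r hr x hx _ _ _
    (hR.mul.app₂_iff.2 ⟨hq, hr, rfl⟩) (hN.smul.app₂_iff.2 ⟨hr, hx, rfl⟩)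
    (hN.smul.app₂_iff.2 ⟨hq, ?_, rfl⟩))).2.2.symm
  exact hN.smul.mem hr hx

theorem IsModule.one_smul (hN : IsModule R a m N b s) {e x : M} (he : IsLeftUnit R m e)
    (hx : Mem x N) : ap₂ s e x = x :=
  (hN.smul.app₂_iff.1 (hN.2.2.2.2.2 e he x hx)).2.2.symm

theorem IsModule.smul_unit (hN : IsModule R a m N b s) {r o : M} (hr : Mem r R)
    (ho : IsLeftUnit N b o) : ap₂ s r o = o := by
  refine hN.add.unit_unique (hN.add.isLeftUnit_of_add_self (hN.smul.mem hr ho.1) ?_) ho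
  rw [← hN.smul_add hr ho.1 ho.1, hN.add.unit_add ho ho.1]

theorem IsModule.unit_smul (hR : IsCommRing R a m) (hN : IsModule R a m N b s) {o z x : M}
    (ho : IsLeftUnit N b o) (hz : IsLeftUnit R a z) (hx : Mem x N) : ap₂ s z x = o := by
  refine hN.add.unit_unique (hN.add.isLeftUnit_of_add_self (hN.smul.mem hz.1 hx) ?_) ho
  rw [← hN.add_smul hR hz.1 hz.1 hx, hR.add.unit_add hz hz.1]

theorem IsModule.intro (hR : IsCommRing R a m) (hN : IsAbGroup N b) (hs : IsOp s R N N)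
    (smul_add : ∀ r x y, Mem r R → Mem x N → Mem y N →
      ap₂ s r (ap₂ b x y) = ap₂ b (ap₂ s r x) (ap₂ s r y))
    (add_smul : ∀ q r x, Mem q R → Mem r R → Mem x N →
      ap₂ s (ap₂ a q r) x = ap₂ b (ap₂ s q x) (ap₂ s r x))
    (mul_smul : ∀ q r x, Mem q R → Mem r R → Mem x N →
      ap₂ s (ap₂ m q r) x = ap₂ s q (ap₂ s r x))
    (one_smul : ∀ e x, IsLeftUnit R m e → Mem x N → ap₂ s e x = x) : IsModule R a m N b s := by
  refine ⟨hN, hs, ?_, ?_, ?_, ?_⟩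
  · intro r hr x hx y hy
    simp only [hN.1.app₂_iff, hs.app₂_iff]
    rintro _ _ _ _ ⟨-, -, rfl⟩ ⟨-, -, rfl⟩ ⟨-, -, rfl⟩ ⟨-, -, rfl⟩
    exact ⟨hr, hN.mem hx hy, (smul_add r x y hr hx hy).symm⟩
  · intro q hq r hr x hx
    simp only [hN.1.app₂_iff, hs.app₂_iff, hR.add.1.app₂_iff]
    rintro _ _ _ _ ⟨-, -, rfl⟩ ⟨-, -, rfl⟩ ⟨-, -, rfl⟩ ⟨-, -, rfl⟩
    exact ⟨hR.add.mem hq hr, hx, (add_smul q r x hq hr hx).symm⟩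
  · intro q hq r hr x hx
    simp only [hs.app₂_iff, hR.mul.app₂_iff]
    rintro _ _ _ ⟨-, -, rfl⟩ ⟨-, -, rfl⟩ ⟨-, -, rfl⟩
    exact ⟨hR.mul.mem hq hr, hx, (mul_smul q r x hq hr hx).symm⟩
  · intro e he x hx
    exact hs.app₂_iff.2 ⟨he.1, hx, (one_smul e x he hx).symm⟩

theorem isLinear_iff {N' b' s' f : M} (hb : IsOp b N N N) (hs : IsOp s R N N)
    (hb' : IsOp b' N' N' N') (hs' : IsOp s' R N' N') :
    IsLinear R N b s N' b' s' f ↔ IsFunc f N N' ∧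
      (∀ x y, Mem x N → Mem y N → ap f (ap₂ b x y) = ap₂ b' (ap f x) (ap f y)) ∧
      ∀ r x, Mem r R → Mem x N → ap f (ap₂ s r x) = ap₂ s' r (ap f x) := by
  refine and_congr_right fun hf => and_congr ?_ ?_
  · simp only [hb.app₂_iff, hf.app_iff, hb'.app₂_iff]
    constructor
    · intro h x y hx hy
      exact (h x y _ _ _ _ ⟨hx, hy, rfl⟩ ⟨hx, rfl⟩ ⟨hy, rfl⟩ ⟨hb.mem hx hy, rfl⟩).2.2
    · rintro h x y _ _ _ _ ⟨hx, hy, rfl⟩ ⟨-, rfl⟩ ⟨-, rfl⟩ ⟨-, rfl⟩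
      exact ⟨hf.ap_mem hx, hf.ap_mem hy, h x y hx hy⟩
  · simp only [hs.app₂_iff, hf.app_iff, hs'.app₂_iff]
    constructor
    · intro h r x hr hx
      exact (h r hr x _ _ _ ⟨hr, hx, rfl⟩ ⟨hx, rfl⟩ ⟨hs.mem hr hx, rfl⟩).2.2
    · rintro h r hr x _ _ _ ⟨-, hx, rfl⟩ ⟨-, rfl⟩ ⟨-, rfl⟩
      exact ⟨hr, hf.ap_mem hx, h r x hr hx⟩

end Modules

/-! ### Sums over finite sets -/

/-- A commutative operation can be summed over the finite subsets of a set. -/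
theorem exists_sum {S P N b : M} (hS : IsFinSubsets S P) (hN : IsAbGroup N b) (val : M → M)
    [hdef : DefFun fun v : ℕ → M => val (v 0)] (hval : ∀ p, Mem p P → Mem (val p) N) :
    ∃ G, IsFunc G S N ∧ IsLeftUnit N b (ap G emp) ∧ ∀ s p, Mem s S → Mem p P → ¬ Mem p s →
      ap G (ins s p) = ap₂ b (val p) (ap G s) := by
  obtain ⟨o, ho, -⟩ := hN.2.2.2
  -- Inside nested quantifiers the argument of `val` has a variable number other than 0.
  have hv (i : ℕ) : DefFun fun v : ℕ → M => val (v i) := DefFun.subst₁ hdef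
  -- Recursion as a least fixed point: `L` is the smallest relation containing `⟨∅, o⟩` and closed
  -- under adding the value of a new element. The quantifier over all sets `Z` is harmless in a
  -- separation formula.
  obtain ⟨L, hL⟩ := exists_sep (cart S N) fun z => ∀ Z, (Mem (pair emp o) Z ∧ ∀ s x p, Mem s S →
    Mem x N → Mem p P → ¬ Mem p s → Mem (pair s x) Z →
      Mem (pair (ins s p) (ap₂ b (val p) x)) Z) → Mem z Z
  have hL' {s x : M} (h : Mem (pair s x) L) : Mem s S ∧ Mem x N :=
    pair_mem_cart.1 ((hL _).1 h).1
  have hL0 : Mem (pair emp o) L :=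
    (hL _).2 ⟨pair_mem_cart.2 ⟨hS.emp_mem, ho.1⟩, fun Z hZ => hZ.1⟩
  have hLs {s x p : M} (hp : Mem p P) (hps : ¬ Mem p s) (h : Mem (pair s x) L) :
      Mem (pair (ins s p) (ap₂ b (val p) x)) L := by
    obtain ⟨hs, hx⟩ := hL' h
    exact (hL _).2 ⟨pair_mem_cart.2 ⟨hS.ins_mem hs hp, hN.mem (hval p hp) hx⟩,
      fun Z hZ => hZ.2 s x p hs hx hp hps (((hL _).1 h).2 Z hZ)⟩
  -- Minimality of `L` gives induction along its generation, since the part of `L` satisfying a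
  -- definable `R` is a set with the same closure properties.
  have ind (R : M → M → Prop) (hR : DefPred fun v : ℕ → M => R (fst (v 0)) (snd (v 0)))
      (h0 : R emp o) (h1 : ∀ s x p, Mem (pair s x) L → Mem p P → ¬ Mem p s → R s x →
        R (ins s p) (ap₂ b (val p) x)) (s x : M) (h : Mem (pair s x) L) : R s x := by
    obtain ⟨Z, hZ⟩ := exists_sep L fun z => R (fst z) (snd z)
    have hZ' (s x : M) : Mem (pair s x) Z ↔ Mem (pair s x) L ∧ R s x := by simp [hZ]
    refine ((hZ' s x).1 (((hL _).1 h).2 Z ⟨(hZ' _ _).2 ⟨hL0, h0⟩, ?_⟩)).2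
    intro s x p hs hx hp hps hsx
    obtain ⟨h, h'⟩ := (hZ' s x).1 hsx
    exact (hZ' _ _).2 ⟨hLs hp hps h, h1 s x p h hp hps h'⟩
  have inv0 : ∀ s x, Mem (pair s x) L → s = emp → x = o := by
    refine ind _ inferInstance (fun _ => rfl) fun s x p _ _ _ _ h => ?_
    exact (not_mem_emp (h ▸ mem_ins.2 (.inr rfl) : Mem p emp)).elim
  -- This is independence of order: any element `q` of `s`, not just the last one inserted, may be
  -- regarded as the last. The two values are exchanged by `IsAbGroup.left_comm`.
  have inv : ∀ s x, Mem (pair s x) L → ∀ q, Mem q s →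
      ∃ y, Mem (pair (del s q) y) L ∧ x = ap₂ b (val q) y := by
    refine ind _ inferInstance (fun q hq => (not_mem_emp hq).elim) ?_
    intro s x p h hp hps ih q hq
    by_cases hqp : p = q
    · subst hqp
      exact ⟨x, by rwa [del_ins hps], rfl⟩
    · have hqs : Mem q s := (mem_ins.1 hq).resolve_right (Ne.symm hqp)
      obtain ⟨y, hy, rfl⟩ := ih q hqs
      refine ⟨ap₂ b (val p) y, ?_, ?_⟩
      · rw [del_ins_of_ne hqp]
        exact hLs hp (by simp [hps]) hy
      · exact hN.left_comm (hval p hp) (hval q (((hS s).1 (hL' h).1).1 q hqs)) (hL' hy).2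
  -- Given `s ∪ {p}`, inversion at `p` reduces any value to a value at `s`, which is unique by
  -- induction. Thus `L` is the graph of a function.
  have ex {s : M} (hs : Mem s S) : ∃ x, ∀ y, Mem (pair s y) L ↔ y = x := by
    refine hS.induction (Q := fun s => ∃ x, ∀ y, Mem (pair s y) L ↔ y = x) ?_ ?_ hs
    · exact ⟨o, fun y => ⟨fun h => inv0 _ _ h rfl, fun h => h ▸ hL0⟩⟩
    · rintro s p hs hp hps ⟨x, hx⟩
      refine ⟨ap₂ b (val p) x, fun y => ⟨fun h => ?_, ?_⟩⟩
      · obtain ⟨z, hz, rfl⟩ := inv _ _ h p (mem_ins.2 (.inr rfl))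
        rw [del_ins hps] at hz
        rw [(hx z).1 hz]
      · rintro rfl
        exact hLs hp hps ((hx x).2 rfl)
  have hfun : IsFunc L S N := by
    refine ⟨fun p hp => ?_, fun s hs => ?_⟩
    · simp only [isOpair_iff]
      exact mem_cart.1 ((hL p).1 hp).1
    · simpa only [app_iff_mem] using ex hs
  have hap {s x : M} (h : Mem (pair s x) L) : ap L s = x :=
    (hfun.app_iff.1 (app_iff_mem.2 h)).2.symm
  refine ⟨L, hfun, by rwa [hap hL0], fun s p hs hp hps => hap (hLs hp hps ?_)⟩
  exact app_iff_mem.1 (hfun.app_iff.2 ⟨hs, rfl⟩)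

end Algebra

/-! ## Families of modules, summations and the coproduct -/

section Family

universe u
variable {M : Type u} [lang.Structure M] [IsModel M]

theorem the_spec {Q : M → Prop} (h : ∃ y, Q y) (h' : ∀ y z, Q y → Q z → y = z) : Q (the Q) := by
  obtain ⟨y, hy⟩ := h
  rwa [the_eq_of_unique hy fun z hz => h' z y hz hy]

/-- The underlying set of the module `F i`. -/
noncomputable def car (F i : M) : M := fst (ap F i)
/-- The addition of the module `F i`. -/
noncomputable def fadd (F i : M) : M := fst (snd (ap F i))
/-- The scalar multiplication of the module `F i`. -/
noncomputable def fsmul (F i : M) : M := snd (snd (ap F i))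
/-- For `p = ⟨r, ⟨i, y⟩⟩`, the product `r · g i y`. -/
noncomputable def term (s g p : M) : M := ap₂ s (fst p) (ap (ap g (fst (snd p))) (snd (snd p)))

instance {a b : (ℕ → M) → M} [DefFun a] [DefFun b] : DefFun fun v => car (a v) (b v) := by
  unfold car; infer_instance
instance {a b c : (ℕ → M) → M} [DefFun a] [DefFun b] [DefFun c] :
    DefFun fun v => term (a v) (b v) (c v) := by unfold term; infer_instance

variable {R a m I F : M}

theorem IsModuleFamily.famAt_iff (hF : IsModuleFamily R a m I F) {i N b s : M} (hi : Mem i I) :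
    FamAt F i N b s ↔ N = car F i ∧ b = fadd F i ∧ s = fsmul F i := by
  obtain ⟨⟨B, hB⟩, hF⟩ := hF
  have key (N b s : M) : FamAt F i N b s ↔ pair N (pair b s) = ap F i := by
    simp [FamAt, hB.app_iff, hi, isTriple_iff, eq_comm]
  obtain ⟨N', b', s', h, -⟩ := hF i hi
  rw [key, car, fadd, fsmul, ← (key _ _ _).1 h]
  simp

theorem IsModuleFamily.module (hF : IsModuleFamily R a m I F) {i : M} (hi : Mem i I) :
    IsModule R a m (car F i) (fadd F i) (fsmul F i) := by
  obtain ⟨N, b, s, h, hN⟩ := hF.2 i hi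
  obtain ⟨rfl, rfl, rfl⟩ := (hF.famAt_iff hi).1 h
  exact hN

theorem IsModuleFamily.isCocone_iff (hF : IsModuleFamily R a m I F) {N b s g : M} :
    IsCocone R I F N b s g ↔ (∃ B, IsFunc g I B) ∧ ∀ i, Mem i I →
      IsLinear R (car F i) (fadd F i) (fsmul F i) N b s (ap g i) := by
  refine and_congr_right fun ⟨B, hB⟩ => forall₂_congr fun i hi => ?_
  simp only [hF.famAt_iff hi, hB.app_iff, hi, true_and]
  constructor
  · intro h
    obtain ⟨f, rfl, hf⟩ := h _ _ _ ⟨rfl, rfl, rfl⟩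
    exact hf
  · rintro h _ _ _ ⟨rfl, rfl, rfl⟩
    exact ⟨_, rfl, h⟩

theorem IsModuleFamily.isDisjointUnion_iff (hF : IsModuleFamily R a m I F) {D : M} :
    IsDisjointUnion D I F ↔
      ∀ p, Mem p D ↔ ∃ i, Mem i I ∧ ∃ y, Mem y (car F i) ∧ p = pair i y := by
  refine forall_congr' fun p => iff_congr Iff.rfl (exists_congr fun i => and_congr_right fun hi => ?_)
  simp only [hF.famAt_iff hi, isOpair_iff]
  constructor
  · rintro ⟨_, _, _, ⟨rfl, rfl, rfl⟩, h⟩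
    exact h
  · exact fun h => ⟨_, _, _, ⟨rfl, rfl, rfl⟩, h⟩

theorem IsModuleFamily.exists_isDisjointUnion (hF : IsModuleFamily R a m I F) :
    ∃ D, IsDisjointUnion D I F := by
  obtain ⟨D, hD⟩ := exists_iUnion I fun i => cart (upair i i) (car F i)
  refine ⟨D, hF.isDisjointUnion_iff.2 fun p => (hD p).trans ?_⟩
  refine exists_congr fun i => and_congr_right fun hi => ?_
  simp [mem_cart]

/-- `G` assigns to each finite subset of `P` the sum of its terms along the cocone `g`. -/
def IsSummation (R a m I F P S N b s g G : M) : Prop :=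
  (IsModule R a m N b s ∧ IsCocone R I F N b s g) ∧ IsFunc G S N ∧ IsLeftUnit N b (ap G emp) ∧
    ∀ x p, Mem x S → Mem p P → ¬ Mem p x → ap G (ins x p) = ap₂ b (term s g p) (ap G x)

set_option synthInstance.maxSize 1000 in
instance {R a m I F P S N b s g G : (ℕ → M) → M} [DefFun R] [DefFun a] [DefFun m] [DefFun I]
    [DefFun F] [DefFun P] [DefFun S] [DefFun N] [DefFun b] [DefFun s] [DefFun g] [DefFun G] :
    DefPred fun v => IsSummation (R v) (a v) (m v) (I v) (F v) (P v) (S v) (N v) (b v) (s v) (g v)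
      (G v) := by
  unfold IsSummation; infer_instance

/-- `x` and `y` have the same sum along every cocone. -/
def SameSum (R a m I F P S x y : M) : Prop :=
  ∀ N b s g G, IsSummation R a m I F P S N b s g G → ap G x = ap G y

/-- The quantifiers range over all modules of the model, a proper class, yet the condition is first
order. Hence it can be used in separation, and no set of test modules has to be found. -/
instance {R a m I F P S : M} {x y : (ℕ → M) → M} [DefFun x] [DefFun y] :
    DefPred fun v => SameSum R a m I F P S (x v) (y v) := by
  unfold SameSum; infer_instance

/-- The class of `x` under `E`. -/
noncomputable def cls (E x : M) : M := the fun z => IsEqClass z E x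

instance {a b : (ℕ → M) → M} [DefFun a] [DefFun b] : DefFun fun v => cls (a v) (b v) := by
  unfold cls IsEqClass; infer_instance

/-- The common value of `G` on the elements of the class `z`. -/
noncomputable def ev (S E G z : M) : M := the fun w => ∃ x, Mem x S ∧ z = cls E x ∧ w = ap G x

instance {a b c d : (ℕ → M) → M} [DefFun a] [DefFun b] [DefFun c] [DefFun d] :
    DefFun fun v => ev (a v) (b v) (c v) (d v) := by
  unfold ev; infer_instance

/-- `S` is the set of finite sets of formal products over the family `F`, and `C` is its quotient
by the relation `E` of having the same sum along every cocone. -/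
structure IsSumQuotient (R a m I F P S E C : M) : Prop where
  ring : IsCommRing R a m
  family : IsModuleFamily R a m I F
  finSubsets : IsFinSubsets S P
  mem_iff : ∀ p, Mem p P ↔ ∃ r i y, Mem r R ∧ Mem i I ∧ Mem y (car F i) ∧ p = pair r (pair i y)
  isEqClass_iff : ∀ z x, IsEqClass z E x ↔ z = cls E x
  cls_eq_iff : ∀ x y, Mem x S → Mem y S → (cls E x = cls E y ↔ SameSum R a m I F P S x y)
  mem_quotient : ∀ z, Mem z C ↔ ∃ x, Mem x S ∧ z = cls E x

variable {P S E C N b s g G : M}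

theorem IsSummation.module (hG : IsSummation R a m I F P S N b s g G) : IsModule R a m N b s :=
  hG.1.1

theorem IsSummation.ap_mem (hG : IsSummation R a m I F P S N b s g G) {x : M} (hx : Mem x S) :
    Mem (ap G x) N := hG.2.1.ap_mem hx

theorem IsSummation.isLeftUnit (hG : IsSummation R a m I F P S N b s g G) :
    IsLeftUnit N b (ap G emp) := hG.2.2.1

theorem IsSummation.ap_ins (hG : IsSummation R a m I F P S N b s g G) {x p : M} (hx : Mem x S)
    (hp : Mem p P) (h : ¬ Mem p x) : ap G (ins x p) = ap₂ b (term s g p) (ap G x) :=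
  hG.2.2.2 x p hx hp h

theorem term_pair (s g r i y : M) : term s g (pair r (pair i y)) = ap₂ s r (ap (ap g i) y) := by
  simp [term]

theorem IsCocone.map (hF : IsModuleFamily R a m I F) (hN : IsModule R a m N b s)
    (hg : IsCocone R I F N b s g) {i : M} (hi : Mem i I) :
    IsFunc (ap g i) (car F i) N ∧
      (∀ x y, Mem x (car F i) → Mem y (car F i) →
        ap (ap g i) (ap₂ (fadd F i) x y) = ap₂ b (ap (ap g i) x) (ap (ap g i) y)) ∧
      ∀ r x, Mem r R → Mem x (car F i) →
        ap (ap g i) (ap₂ (fsmul F i) r x) = ap₂ s r (ap (ap g i) x) := by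
  have hi' := hF.module hi
  exact (isLinear_iff hi'.add.1 hi'.smul hN.add.1 hN.smul).1 ((hF.isCocone_iff.1 hg).2 i hi)

namespace IsSumQuotient

theorem map (h : IsSumQuotient R a m I F P S E C) (hG : IsSummation R a m I F P S N b s g G)
    {i : M} (hi : Mem i I) :
    IsFunc (ap g i) (car F i) N ∧
      (∀ x y, Mem x (car F i) → Mem y (car F i) →
        ap (ap g i) (ap₂ (fadd F i) x y) = ap₂ b (ap (ap g i) x) (ap (ap g i) y)) ∧
      ∀ r x, Mem r R → Mem x (car F i) →
        ap (ap g i) (ap₂ (fsmul F i) r x) = ap₂ s r (ap (ap g i) x) :=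
  hG.1.2.map h.family hG.module hi

theorem pair_mem (h : IsSumQuotient R a m I F P S E C) {r i y : M} (hr : Mem r R) (hi : Mem i I)
    (hy : Mem y (car F i)) : Mem (pair r (pair i y)) P :=
  (h.mem_iff _).2 ⟨r, i, y, hr, hi, hy, rfl⟩

theorem term_mem (h : IsSumQuotient R a m I F P S E C) (hN : IsModule R a m N b s)
    (hg : IsCocone R I F N b s g) {p : M} (hp : Mem p P) : Mem (term s g p) N := by
  obtain ⟨r, i, y, hr, hi, hy, rfl⟩ := (h.mem_iff p).1 hp
  rw [term_pair]
  exact hN.smul.mem hr ((hg.map h.family hN hi).1.ap_mem hy)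

theorem exists_isSummation (h : IsSumQuotient R a m I F P S E C) (hN : IsModule R a m N b s)
    (hg : IsCocone R I F N b s g) : ∃ G, IsSummation R a m I F P S N b s g G := by
  obtain ⟨G, hG, h0, h1⟩ := exists_sum h.finSubsets hN.add (fun p => term s g p)
    fun p hp => h.term_mem hN hg hp
  exact ⟨G, ⟨hN, hg⟩, hG, h0, h1⟩

end IsSumQuotient

/-- No two elements of `x` belong to the same index. -/
def IsReduced (x : M) : Prop :=
  ∀ p q, Mem p x → Mem q x → fst (snd p) = fst (snd q) → p = q

instance {a : (ℕ → M) → M} [DefFun a] : DefPred fun v => IsReduced (a v) := by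
  unfold IsReduced; infer_instance

/-! ### Finite sets representing sums and scalar multiples -/

namespace IsSumQuotient

/-- Inserting `p` fails to add its term when `p` is already in `x`. If `x` has an element `q` with
the index of `p`, it is replaced by one formal product carrying both terms; otherwise `p` is new and
is inserted. The set `z` does not depend on the cocone, as is needed later to define operations on
classes. -/
theorem exists_reduced_add_term (h : IsSumQuotient R a m I F P S E C) {x p : M} (hx : Mem x S)
    (hx' : IsReduced x) (hp : Mem p P) : ∃ z, Mem z S ∧ IsReduced z ∧ ∀ N b s g G,
      IsSummation R a m I F P S N b s g G → ap G z = ap₂ b (term s g p) (ap G x) := by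
  by_cases hq : ∃ q, Mem q x ∧ fst (snd q) = fst (snd p)
  · obtain ⟨q, hqx, hqp⟩ := hq
    have hqP := ((h.finSubsets x).1 hx).1 q hqx
    obtain ⟨r, i, y, hr, hi, hy, rfl⟩ := (h.mem_iff p).1 hp
    obtain ⟨r', i', y', hr', hi', hy', rfl⟩ := (h.mem_iff q).1 hqP
    obtain rfl : i' = i := by simpa using hqp
    obtain ⟨e, he⟩ := h.ring.exists_one
    have hFi := h.family.module hi
    have hy₁ := hFi.smul.mem hr hy
    have hy₂ := hFi.smul.mem hr' hy'
    -- The merged product is `1 · (r y + r' y')`: the coefficients are absorbed into the module at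
    -- the common index, and linearity of the cocone recovers both terms.
    have hw := h.pair_mem he.1 hi (hFi.add.mem hy₁ hy₂)
    have hd := h.finSubsets.del_mem hx (pair r' (pair i' y'))
    -- As `x` is reduced, nothing of index `i'` is left after removing `q`. So the merged product is
    -- new and the resulting set is again reduced.
    have hidx (z : M) (hz : Mem z (del x (pair r' (pair i' y')))) : ¬ fst (snd z) = i' := by
      intro hz'
      obtain ⟨hz, hne⟩ := mem_del.1 hz
      exact hne (hx' _ _ hz hqx (by simpa using hz'))
    have hn : ¬ Mem (pair e (pair i' (ap₂ (fadd F i') (ap₂ (fsmul F i') r y)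
        (ap₂ (fsmul F i') r' y')))) (del x (pair r' (pair i' y'))) := fun hm =>
      hidx _ hm (by simp)
    refine ⟨_, h.finSubsets.ins_mem hd hw, ?_, ?_⟩
    · intro z w hz hw hzw
      rcases mem_ins.1 hz with hz | rfl <;> rcases mem_ins.1 hw with hw | rfl
      · exact hx' z w (mem_del.1 hz).1 (mem_del.1 hw).1 hzw
      · exact (hidx z hz (by simpa using hzw)).elim
      · exact (hidx w hw (by simpa using hzw.symm)).elim
      · rfl
    · intro N b s g G hG
      obtain ⟨hg, hga, hgs⟩ := h.map hG hi
      have hN := hG.module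
      have hgy := hg.ap_mem hy
      have hgy' := hg.ap_mem hy'
      have hx'' : ap G x = ap₂ b (ap₂ s r' (ap (ap g i') y'))
          (ap G (del x (pair r' (pair i' y')))) := by
        conv_lhs => rw [← ins_del hqx]
        rw [hG.ap_ins hd hqP (by simp), term_pair]
      rw [hG.ap_ins hd hw hn, hx'', term_pair, term_pair, hga _ _ hy₁ hy₂, hgs _ _ hr hy,
        hgs _ _ hr' hy']
      have h1 := hN.smul.mem hr hgy
      have h2 := hN.smul.mem hr' hgy'
      rw [hN.one_smul he (hN.add.mem h1 h2), hN.add.assoc h1 h2 (hG.ap_mem hd)]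
  · have hpx : ¬ Mem p x := fun hpx => hq ⟨p, hpx, rfl⟩
    refine ⟨_, h.finSubsets.ins_mem hx hp, ?_, fun N b s g G hG => hG.ap_ins hx hp hpx⟩
    intro z w hz hw hzw
    rcases mem_ins.1 hz with hzx | rfl <;> rcases mem_ins.1 hw with hwx | rfl
    · exact hx' z w hzx hwx hzw
    · exact (hq ⟨z, hzx, hzw⟩).elim
    · exact (hq ⟨w, hwx, hzw.symm⟩).elim
    · rfl

theorem exists_reduced (h : IsSumQuotient R a m I F P S E C) {x : M} (hx : Mem x S) :
    ∃ z, Mem z S ∧ IsReduced z ∧ SameSum R a m I F P S z x := by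
  refine h.finSubsets.induction
    (Q := fun x => ∃ z, Mem z S ∧ IsReduced z ∧ SameSum R a m I F P S z x) ?_ ?_ hx
  · exact ⟨emp, h.finSubsets.emp_mem, fun p q hp => (not_mem_emp hp).elim, fun _ _ _ _ _ _ => rfl⟩
  · rintro x p hx hp hpx ⟨z, hz, hz', hzx⟩
    obtain ⟨w, hw, hw', hwz⟩ := h.exists_reduced_add_term hz hz' hp
    refine ⟨w, hw, hw', fun N b s g G hG => ?_⟩
    rw [hwz _ _ _ _ _ hG, hzx _ _ _ _ _ hG, hG.ap_ins hx hp hpx]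

/-- Passing first to a reduced set with the same sums removes the hypothesis that `x` is reduced. -/
theorem exists_add_term (h : IsSumQuotient R a m I F P S E C) {x p : M} (hx : Mem x S)
    (hp : Mem p P) : ∃ z, Mem z S ∧ ∀ N b s g G,
      IsSummation R a m I F P S N b s g G → ap G z = ap₂ b (term s g p) (ap G x) := by
  obtain ⟨w, hw, hw', hwx⟩ := h.exists_reduced hx
  obtain ⟨z, hz, -, hzw⟩ := h.exists_reduced_add_term hw hw' hp
  exact ⟨z, hz, fun N b s g G hG => by rw [hzw _ _ _ _ _ hG, hwx _ _ _ _ _ hG]⟩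

/-- The terms of `x` are added to `y` one at a time, which copes with elements common to both. -/
theorem exists_add (h : IsSumQuotient R a m I F P S E C) {x y : M} (hx : Mem x S) (hy : Mem y S) :
    ∃ z, Mem z S ∧ ∀ N b s g G,
      IsSummation R a m I F P S N b s g G → ap G z = ap₂ b (ap G x) (ap G y) := by
  refine h.finSubsets.induction (Q := fun x => ∃ z, Mem z S ∧ ∀ N b s g G,
      IsSummation R a m I F P S N b s g G → ap G z = ap₂ b (ap G x) (ap G y)) ?_ ?_ hx
  · refine ⟨y, hy, fun N b s g G hG => ?_⟩
    rw [hG.module.add.unit_add hG.isLeftUnit (hG.ap_mem hy)]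
  · rintro x p hx hp hpx ⟨z, hz, hz'⟩
    obtain ⟨w, hw, hw'⟩ := h.exists_add_term hz hp
    refine ⟨w, hw, fun N b s g G hG => ?_⟩
    rw [hw' _ _ _ _ _ hG, hz' _ _ _ _ _ hG, hG.ap_ins hx hp hpx,
      hG.module.add.assoc (h.term_mem hG.module hG.1.2 hp) (hG.ap_mem hx) (hG.ap_mem hy)]

/-- Each coefficient `r'` becomes `r r'`. Distinct formal products may then coincide, so the scaled
terms are added by `exists_add_term` rather than collected as an image. -/
theorem exists_smul (h : IsSumQuotient R a m I F P S E C) {r x : M} (hr : Mem r R) (hx : Mem x S) :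
    ∃ z, Mem z S ∧ ∀ N b s g G,
      IsSummation R a m I F P S N b s g G → ap G z = ap₂ s r (ap G x) := by
  refine h.finSubsets.induction (Q := fun x => ∃ z, Mem z S ∧ ∀ N b s g G,
      IsSummation R a m I F P S N b s g G → ap G z = ap₂ s r (ap G x)) ?_ ?_ hx
  · exact ⟨emp, h.finSubsets.emp_mem, fun N b s g G hG =>
      (hG.module.smul_unit hr hG.isLeftUnit).symm⟩
  · rintro x p hx hp hpx ⟨z, hz, hz'⟩
    obtain ⟨r', i, y, hr', hi, hy, rfl⟩ := (h.mem_iff p).1 hp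
    obtain ⟨w, hw, hw'⟩ := h.exists_add_term hz (h.pair_mem (h.ring.mul.mem hr hr') hi hy)
    refine ⟨w, hw, fun N b s g G hG => ?_⟩
    have hgy := (h.map hG hi).1.ap_mem hy
    rw [hw' _ _ _ _ _ hG, hz' _ _ _ _ _ hG, hG.ap_ins hx hp hpx, term_pair, term_pair,
      hG.module.mul_smul h.ring hr hr' hgy,
      hG.module.smul_add hr (hG.module.smul.mem hr' hgy) (hG.ap_mem hx)]

end IsSumQuotient

end Family

/-! ## The coproduct -/

section Coproduct

universe u
variable {M : Type u} [lang.Structure M] [IsModel M] {R a m I F P S E C N b s g G : M}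

/-! ### Evaluations on the quotient, and the operations they determine -/

namespace IsSumQuotient

theorem cls_mem (h : IsSumQuotient R a m I F P S E C) {x : M} (hx : Mem x S) : Mem (cls E x) C :=
  (h.mem_quotient _).2 ⟨x, hx, rfl⟩

theorem ev_cls (h : IsSumQuotient R a m I F P S E C) (hG : IsSummation R a m I F P S N b s g G)
    {x : M} (hx : Mem x S) : ev S E G (cls E x) = ap G x := by
  refine the_eq_of_unique ⟨x, hx, rfl, rfl⟩ ?_
  rintro _ ⟨y, hy, hxy, rfl⟩
  exact ((h.cls_eq_iff x y hx hy).1 hxy _ _ _ _ _ hG).symm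

theorem ev_mem (h : IsSumQuotient R a m I F P S E C) (hG : IsSummation R a m I F P S N b s g G)
    {z : M} (hz : Mem z C) : Mem (ev S E G z) N := by
  obtain ⟨x, hx, rfl⟩ := (h.mem_quotient z).1 hz
  rw [h.ev_cls hG hx]
  exact hG.ap_mem hx

/-- Since `E` identifies exactly the sets with equal sums, the evaluations are jointly injective on
`C`. Every identity in `C` below is checked after evaluation. -/
theorem ev_ext (h : IsSumQuotient R a m I F P S E C) {z w : M} (hz : Mem z C) (hw : Mem w C)
    (hzw : ∀ N b s g G, IsSummation R a m I F P S N b s g G → ev S E G z = ev S E G w) :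
    z = w := by
  obtain ⟨x, hx, rfl⟩ := (h.mem_quotient z).1 hz
  obtain ⟨y, hy, rfl⟩ := (h.mem_quotient w).1 hw
  refine (h.cls_eq_iff x y hx hy).2 fun N b s g G hG => ?_
  rw [← h.ev_cls hG hx, ← h.ev_cls hG hy, hzw _ _ _ _ _ hG]

/-- Representatives show that an element with the required evaluations exists, and `ev_ext` shows
that it is unique. A definite description then gives the operation with no choice of
representatives; scalar multiplication and the inclusions are obtained likewise. -/
theorem exists_addition (h : IsSumQuotient R a m I F P S E C) : ∃ c, IsOp c C C C ∧
    ∀ z w, Mem z C → Mem w C → ∀ N b s g G, IsSummation R a m I F P S N b s g G →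
      ev S E G (ap₂ c z w) = ap₂ b (ev S E G z) (ev S E G w) := by
  have key (z w : M) (hz : Mem z C) (hw : Mem w C) :=
    the_spec (Q := fun u => Mem u C ∧ ∀ N b s g G, IsSummation R a m I F P S N b s g G →
      ev S E G u = ap₂ b (ev S E G z) (ev S E G w)) (by
        obtain ⟨x, hx, rfl⟩ := (h.mem_quotient z).1 hz
        obtain ⟨y, hy, rfl⟩ := (h.mem_quotient w).1 hw
        obtain ⟨u, hu, hu'⟩ := h.exists_add hx hy
        refine ⟨cls E u, h.cls_mem hu, fun N b s g G hG => ?_⟩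
        rw [h.ev_cls hG hx, h.ev_cls hG hy, h.ev_cls hG hu, hu' _ _ _ _ _ hG])
      fun u v hu hv => h.ev_ext hu.1 hv.1 fun N b s g G hG => by
        rw [hu.2 _ _ _ _ _ hG, hv.2 _ _ _ _ _ hG]
  obtain ⟨c, hc, hc'⟩ := exists_isOp (A := C) (B := C) (C := C)
    (fun z w => the fun u => Mem u C ∧ ∀ N b s g G, IsSummation R a m I F P S N b s g G →
      ev S E G u = ap₂ b (ev S E G z) (ev S E G w)) fun z w hz hw => (key z w hz hw).1
  refine ⟨c, hc, fun z w hz hw => ?_⟩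
  rw [hc' z w hz hw]
  exact (key z w hz hw).2

theorem exists_scalar (h : IsSumQuotient R a m I F P S E C) : ∃ t, IsOp t R C C ∧
    ∀ r z, Mem r R → Mem z C → ∀ N b s g G, IsSummation R a m I F P S N b s g G →
      ev S E G (ap₂ t r z) = ap₂ s r (ev S E G z) := by
  have key (r z : M) (hr : Mem r R) (hz : Mem z C) :=
    the_spec (Q := fun u => Mem u C ∧ ∀ N b s g G, IsSummation R a m I F P S N b s g G →
      ev S E G u = ap₂ s r (ev S E G z)) (by
        obtain ⟨x, hx, rfl⟩ := (h.mem_quotient z).1 hz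
        obtain ⟨u, hu, hu'⟩ := h.exists_smul hr hx
        refine ⟨cls E u, h.cls_mem hu, fun N b s g G hG => ?_⟩
        rw [h.ev_cls hG hx, h.ev_cls hG hu, hu' _ _ _ _ _ hG])
      fun u v hu hv => h.ev_ext hu.1 hv.1 fun N b s g G hG => by
        rw [hu.2 _ _ _ _ _ hG, hv.2 _ _ _ _ _ hG]
  obtain ⟨t, ht, ht'⟩ := exists_isOp (A := R) (B := C) (C := C)
    (fun r z => the fun u => Mem u C ∧ ∀ N b s g G, IsSummation R a m I F P S N b s g G →
      ev S E G u = ap₂ s r (ev S E G z)) fun r z hr hz => (key r z hr hz).1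
  refine ⟨t, ht, fun r z hr hz => ?_⟩
  rw [ht' r z hr hz]
  exact (key r z hr hz).2

theorem exists_inclusion (h : IsSumQuotient R a m I F P S E C) {i : M} (hi : Mem i I) :
    ∃ f, IsFunc f (car F i) C ∧ ∀ y, Mem y (car F i) → ∀ N b s g G,
      IsSummation R a m I F P S N b s g G → ev S E G (ap f y) = ap (ap g i) y := by
  have key (y : M) (hy : Mem y (car F i)) :=
    the_spec (Q := fun u => Mem u C ∧ ∀ N b s g G, IsSummation R a m I F P S N b s g G →
      ev S E G u = ap (ap g i) y) (by
        obtain ⟨e, he⟩ := h.ring.exists_one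
        -- The image of `y` is represented by adding the single term `1 · y` to the empty sum.
        obtain ⟨u, hu, hu'⟩ :=
          h.exists_add_term h.finSubsets.emp_mem (h.pair_mem he.1 hi hy)
        refine ⟨cls E u, h.cls_mem hu, fun N b s g G hG => ?_⟩
        have hgy := (h.map hG hi).1.ap_mem hy
        rw [h.ev_cls hG hu, hu' _ _ _ _ _ hG, term_pair, hG.module.one_smul he hgy,
          hG.module.add.comm hgy hG.isLeftUnit.1, hG.module.add.unit_add hG.isLeftUnit hgy])
      fun u v hu hv => h.ev_ext hu.1 hv.1 fun N b s g G hG => by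
        rw [hu.2 _ _ _ _ _ hG, hv.2 _ _ _ _ _ hG]
  obtain ⟨f, hf, hf'⟩ := exists_isFunc (A := car F i) (B := C)
    (fun y => the fun u => Mem u C ∧ ∀ N b s g G, IsSummation R a m I F P S N b s g G →
      ev S E G u = ap (ap g i) y) fun y hy => (key y hy).1
  refine ⟨f, hf, fun y hy => ?_⟩
  rw [hf' y hy]
  exact (key y hy).2

/-- Each inclusion is determined by its evaluations, so the family of all of them is a definable
function of `i`; replacement supplies a set `B` as its codomain. -/
theorem exists_inclusions (h : IsSumQuotient R a m I F P S E C) :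
    ∃ j, (∃ B, IsFunc j I B) ∧ ∀ i, Mem i I → IsFunc (ap j i) (car F i) C ∧
      ∀ y, Mem y (car F i) → ∀ N b s g G,
        IsSummation R a m I F P S N b s g G → ev S E G (ap (ap j i) y) = ap (ap g i) y := by
  have key (i : M) (hi : Mem i I) :=
    the_spec (Q := fun f => IsFunc f (car F i) C ∧ ∀ y, Mem y (car F i) → ∀ N b s g G,
      IsSummation R a m I F P S N b s g G → ev S E G (ap f y) = ap (ap g i) y)
      (h.exists_inclusion hi) fun f f' hf hf' => hf.1.ext hf'.1 fun y hy =>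
        h.ev_ext (hf.1.ap_mem hy) (hf'.1.ap_mem hy) fun N b s g G hG => by
          rw [hf.2 y hy _ _ _ _ _ hG, hf'.2 y hy _ _ _ _ _ hG]
  obtain ⟨B, hB⟩ := exists_image I fun i => the fun f => IsFunc f (car F i) C ∧
    ∀ y, Mem y (car F i) → ∀ N b s g G,
      IsSummation R a m I F P S N b s g G → ev S E G (ap f y) = ap (ap g i) y
  obtain ⟨j, hj, hj'⟩ := exists_isFunc (A := I) (B := B) (fun i => the fun f =>
    IsFunc f (car F i) C ∧ ∀ y, Mem y (car F i) → ∀ N b s g G,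
      IsSummation R a m I F P S N b s g G → ev S E G (ap f y) = ap (ap g i) y)
    fun i hi => (hB _).2 ⟨i, hi, rfl⟩
  refine ⟨j, ⟨B, hj⟩, fun i hi => ?_⟩
  rw [hj' i hi]
  exact key i hi

end IsSumQuotient

/-- The operations and the inclusions of the coproduct, as determined by evaluation along all
cocones. -/
structure IsSumModule (R a m I F P S E C c t j : M) : Prop extends
    IsSumQuotient R a m I F P S E C where
  isOp_add : IsOp c C C C
  ev_add : ∀ z w, Mem z C → Mem w C → ∀ N b s g G, IsSummation R a m I F P S N b s g G →
    ev S E G (ap₂ c z w) = ap₂ b (ev S E G z) (ev S E G w)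
  isOp_smul : IsOp t R C C
  ev_smul : ∀ r z, Mem r R → Mem z C → ∀ N b s g G, IsSummation R a m I F P S N b s g G →
    ev S E G (ap₂ t r z) = ap₂ s r (ev S E G z)
  isFunc : ∃ B, IsFunc j I B
  isFunc_ap : ∀ i, Mem i I → IsFunc (ap j i) (car F i) C
  ev_inclusion : ∀ i, Mem i I → ∀ y, Mem y (car F i) → ∀ N b s g G,
    IsSummation R a m I F P S N b s g G → ev S E G (ap (ap j i) y) = ap (ap g i) y

theorem IsSumQuotient.exists_isSumModule (h : IsSumQuotient R a m I F P S E C) :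
    ∃ c t j, IsSumModule R a m I F P S E C c t j := by
  obtain ⟨c, hc, hc'⟩ := h.exists_addition
  obtain ⟨t, ht, ht'⟩ := h.exists_scalar
  obtain ⟨j, hj, hj'⟩ := h.exists_inclusions
  exact ⟨c, t, j, h, hc, hc', ht, ht', hj, fun i hi => (hj' i hi).1, fun i hi => (hj' i hi).2⟩

/-! ### Module laws, cocone and universal property -/

namespace IsSumModule

variable {c t j : M}

theorem isAbGroup_and_isLeftUnit (h : IsSumModule R a m I F P S E C c t j) :
    IsAbGroup C c ∧ IsLeftUnit C c (cls E emp) := by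
  have h₀ := h.toIsSumQuotient
  have hc := h.isOp_add
  have hemp := h.finSubsets.emp_mem
  have hunit (x : M) (hx : Mem x C) : ap₂ c (cls E emp) x = x := by
    refine h₀.ev_ext (hc.mem (h₀.cls_mem hemp) hx) hx fun N b s g G hG => ?_
    rw [h.ev_add _ _ (h₀.cls_mem hemp) hx _ _ _ _ _ hG, h₀.ev_cls hG hemp,
      hG.module.add.unit_add hG.isLeftUnit (h₀.ev_mem hG hx)]
  refine ⟨IsAbGroup.intro hc ?_ ?_ (h₀.cls_mem hemp) hunit ?_,
    hc.isLeftUnit_iff.2 ⟨h₀.cls_mem hemp, hunit⟩⟩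
  · intro x y z hx hy hz
    have hxy := hc.mem hx hy
    have hyz := hc.mem hy hz
    refine h₀.ev_ext (hc.mem hxy hz) (hc.mem hx hyz) fun N b s g G hG => ?_
    rw [h.ev_add _ _ hxy hz _ _ _ _ _ hG, h.ev_add _ _ hx hy _ _ _ _ _ hG,
      h.ev_add _ _ hx hyz _ _ _ _ _ hG, h.ev_add _ _ hy hz _ _ _ _ _ hG,
      hG.module.add.assoc (h₀.ev_mem hG hx) (h₀.ev_mem hG hy) (h₀.ev_mem hG hz)]
  · intro x y hx hy
    refine h₀.ev_ext (hc.mem hx hy) (hc.mem hy hx) fun N b s g G hG => ?_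
    rw [h.ev_add _ _ hx hy _ _ _ _ _ hG, h.ev_add _ _ hy hx _ _ _ _ _ hG,
      hG.module.add.comm (h₀.ev_mem hG hx) (h₀.ev_mem hG hy)]
  · intro x hx
    obtain ⟨e, he⟩ := h.ring.exists_one
    obtain ⟨o, ho, -⟩ := h.ring.add.2.2.2
    -- With `e' = -1` in the ring, the negative of `x` is `e' · x`, so no separate construction of
    -- negatives is needed.
    obtain ⟨e', he', hee'⟩ := h.ring.add.exists_add_eq ho he.1
    have hx' := h.isOp_smul.mem he' hx
    refine ⟨_, hx', h₀.ev_ext (hc.mem hx hx') (h₀.cls_mem hemp) fun N b s g G hG => ?_⟩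
    have hN := hG.module
    have hm := h₀.ev_mem hG hx
    rw [h.ev_add _ _ hx hx' _ _ _ _ _ hG, h.ev_smul _ _ he' hx _ _ _ _ _ hG, h₀.ev_cls hG hemp]
    have hsum := hN.add_smul h.ring he.1 he' hm
    rw [hee', hN.unit_smul h.ring hG.isLeftUnit ho hm, hN.one_smul he hm] at hsum
    exact hsum.symm

theorem isModule (h : IsSumModule R a m I F P S E C c t j) : IsModule R a m C c t := by
  have h₀ := h.toIsSumQuotient
  have hc := h.isOp_add
  have ht := h.isOp_smul
  refine IsModule.intro h.ring h.isAbGroup_and_isLeftUnit.1 ht ?_ ?_ ?_ ?_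
  · intro r x y hr hx hy
    have hrx := ht.mem hr hx
    have hry := ht.mem hr hy
    have hxy := hc.mem hx hy
    refine h₀.ev_ext (ht.mem hr hxy) (hc.mem hrx hry) fun N b s g G hG => ?_
    rw [h.ev_smul _ _ hr hxy _ _ _ _ _ hG, h.ev_add _ _ hx hy _ _ _ _ _ hG,
      h.ev_add _ _ hrx hry _ _ _ _ _ hG, h.ev_smul _ _ hr hx _ _ _ _ _ hG,
      h.ev_smul _ _ hr hy _ _ _ _ _ hG,
      hG.module.smul_add hr (h₀.ev_mem hG hx) (h₀.ev_mem hG hy)]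
  · intro q r x hq hr hx
    have hqr := h.ring.add.mem hq hr
    have hqx := ht.mem hq hx
    have hrx := ht.mem hr hx
    refine h₀.ev_ext (ht.mem hqr hx) (hc.mem hqx hrx) fun N b s g G hG => ?_
    rw [h.ev_smul _ _ hqr hx _ _ _ _ _ hG, h.ev_add _ _ hqx hrx _ _ _ _ _ hG,
      h.ev_smul _ _ hq hx _ _ _ _ _ hG, h.ev_smul _ _ hr hx _ _ _ _ _ hG,
      hG.module.add_smul h.ring hq hr (h₀.ev_mem hG hx)]
  · intro q r x hq hr hx
    have hqr := h.ring.mul.mem hq hr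
    have hrx := ht.mem hr hx
    refine h₀.ev_ext (ht.mem hqr hx) (ht.mem hq hrx) fun N b s g G hG => ?_
    rw [h.ev_smul _ _ hqr hx _ _ _ _ _ hG, h.ev_smul _ _ hq hrx _ _ _ _ _ hG,
      h.ev_smul _ _ hr hx _ _ _ _ _ hG, hG.module.mul_smul h.ring hq hr (h₀.ev_mem hG hx)]
  · intro e x he hx
    refine h₀.ev_ext (ht.mem he.1 hx) hx fun N b s g G hG => ?_
    rw [h.ev_smul _ _ he.1 hx _ _ _ _ _ hG, hG.module.one_smul he (h₀.ev_mem hG hx)]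

theorem isCocone (h : IsSumModule R a m I F P S E C c t j) : IsCocone R I F C c t j := by
  have h₀ := h.toIsSumQuotient
  refine h.family.isCocone_iff.2 ⟨h.isFunc, fun i hi => ?_⟩
  have hF := h.family.module hi
  have hj := h.isFunc_ap i hi
  refine (isLinear_iff hF.add.1 hF.smul h.isOp_add h.isOp_smul).2 ⟨hj, ?_, ?_⟩
  · intro x y hx hy
    have hxy := hF.add.mem hx hy
    refine h₀.ev_ext (hj.ap_mem hxy) (h.isOp_add.mem (hj.ap_mem hx) (hj.ap_mem hy))
      fun N b s g G hG => ?_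
    rw [h.ev_inclusion i hi _ hxy _ _ _ _ _ hG,
      h.ev_add _ _ (hj.ap_mem hx) (hj.ap_mem hy) _ _ _ _ _ hG,
      h.ev_inclusion i hi _ hx _ _ _ _ _ hG, h.ev_inclusion i hi _ hy _ _ _ _ _ hG,
      (h₀.map hG hi).2.1 x y hx hy]
  · intro r x hr hx
    have hrx := hF.smul.mem hr hx
    refine h₀.ev_ext (hj.ap_mem hrx) (h.isOp_smul.mem hr (hj.ap_mem hx)) fun N b s g G hG => ?_
    rw [h.ev_inclusion i hi _ hrx _ _ _ _ _ hG, h.ev_smul _ _ hr (hj.ap_mem hx) _ _ _ _ _ hG,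
      h.ev_inclusion i hi _ hx _ _ _ _ _ hG, (h₀.map hG hi).2.2 r x hr hx]

/-- Both sides evaluate to the recursion step of a summation. This says that a class is the sum in
`C` of its formal products; it serves both the sum rule and uniqueness in the universal property. -/
theorem cls_ins (h : IsSumModule R a m I F P S E C c t j) {x r i y : M} (hx : Mem x S)
    (hr : Mem r R) (hi : Mem i I) (hy : Mem y (car F i)) (hn : ¬ Mem (pair r (pair i y)) x) :
    cls E (ins x (pair r (pair i y))) = ap₂ c (ap₂ t r (ap (ap j i) y)) (cls E x) := by
  have h₀ := h.toIsSumQuotient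
  have hp := h₀.pair_mem hr hi hy
  have hx' := h.finSubsets.ins_mem hx hp
  have hj := (h.isFunc_ap i hi).ap_mem hy
  have hrj := h.isOp_smul.mem hr hj
  refine h₀.ev_ext (h₀.cls_mem hx') (h.isOp_add.mem hrj (h₀.cls_mem hx)) fun N b s g G hG => ?_
  rw [h₀.ev_cls hG hx', hG.ap_ins hx hp hn, h.ev_add _ _ hrj (h₀.cls_mem hx) _ _ _ _ _ hG,
    h.ev_smul _ _ hr hj _ _ _ _ _ hG, h.ev_inclusion i hi _ hy _ _ _ _ _ hG, h₀.ev_cls hG hx,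
    term_pair]

theorem factors_iff (h : IsSumModule R a m I F P S E C c t j) (hN : IsModule R a m N b s)
    (hg : IsCocone R I F N b s g) {f : M} (hf : IsFunc f C N) : Factors I j f g ↔
      ∀ i y, Mem i I → Mem y (car F i) → ap f (ap (ap j i) y) = ap (ap g i) y := by
  obtain ⟨B, hj⟩ := h.isFunc
  obtain ⟨B', hgB⟩ := hg.1
  constructor
  · intro H i y hi hy
    have hj' := h.isFunc_ap i hi
    exact ((hg.map h.family hN hi).1.app_iff.1 (H i hi _ _ (hj.app_iff.2 ⟨hi, rfl⟩)
      (hgB.app_iff.2 ⟨hi, rfl⟩) y _ _ (hj'.app_iff.2 ⟨hy, rfl⟩)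
      (hf.app_iff.2 ⟨hj'.ap_mem hy, rfl⟩))).2
  · intro H i hi f₁ f₂ h₁ h₂ y z w hyz hzw
    obtain ⟨-, rfl⟩ := hj.app_iff.1 h₁
    obtain ⟨-, rfl⟩ := hgB.app_iff.1 h₂
    obtain ⟨hy, rfl⟩ := (h.isFunc_ap i hi).app_iff.1 hyz
    obtain ⟨-, rfl⟩ := hf.app_iff.1 hzw
    exact (hg.map h.family hN hi).1.app_iff.2 ⟨hy, H i y hi hy⟩

theorem isCoproduct (h : IsSumModule R a m I F P S E C c t j) :
    IsCoproduct R a m I F C c t j := by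
  have h₀ := h.toIsSumQuotient
  have hC := h.isModule
  refine ⟨hC, h.isCocone, fun N b s g hN hg => ?_⟩
  -- The map out of `C` is evaluation along the given cocone; its linearity and compatibility with
  -- the inclusions are the defining properties of the structure on `C`.
  obtain ⟨G, hG⟩ := h₀.exists_isSummation hN hg
  obtain ⟨f, hf, hf'⟩ := exists_isFunc (A := C) (B := N) (fun z => ev S E G z)
    fun z hz => h₀.ev_mem hG hz
  refine ⟨f, fun f' => ?_⟩
  rw [isLinear_iff hC.add.1 hC.smul hN.add.1 hN.smul]
  constructor
  · rintro ⟨⟨hfun, hadd, hsmul⟩, hfac⟩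
    rw [h.factors_iff hN hg hfun] at hfac
    refine hfun.ext hf fun z hz => ?_
    rw [hf' z hz]
    obtain ⟨x, hx, rfl⟩ := (h₀.mem_quotient z).1 hz
    rw [h₀.ev_cls hG hx]
    -- Uniqueness: classes of finite sets are built from zero by adding terms `r · j i y`, where a
    -- competing map is forced by linearity and the factorisation.
    refine h.finSubsets.induction (Q := fun x => ap f' (cls E x) = ap G x) ?_ ?_ hx
    · have hu := h.isAbGroup_and_isLeftUnit.2
      refine hN.add.unit_unique (hN.add.isLeftUnit_of_add_self (hfun.ap_mem hu.1) ?_) hG.isLeftUnit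
      rw [← hadd _ _ hu.1 hu.1, hC.add.unit_add hu hu.1]
    · intro x p hx hp hpx ih
      obtain ⟨r, i, y, hr, hi, hy, rfl⟩ := (h.mem_iff p).1 hp
      have hj := (h.isFunc_ap i hi).ap_mem hy
      rw [h.cls_ins hx hr hi hy hpx, hadd _ _ (hC.smul.mem hr hj) (h₀.cls_mem hx),
        hsmul _ _ hr hj, hfac i y hi hy, ih, hG.ap_ins hx hp hpx, term_pair]
  · rintro rfl
    refine ⟨⟨hf, fun x y hx hy => ?_, fun r x hr hx => ?_⟩,
      (h.factors_iff hN hg hf).2 fun i y hi hy => ?_⟩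
    · rw [hf' _ (hC.add.mem hx hy), hf' x hx, hf' y hy, h.ev_add x y hx hy _ _ _ _ _ hG]
    · rw [hf' _ (hC.smul.mem hr hx), hf' x hx, h.ev_smul r x hr hx _ _ _ _ _ hG]
    · rw [hf' _ ((h.isFunc_ap i hi).ap_mem hy), h.ev_inclusion i hi y hy _ _ _ _ _ hG]

theorem sumRule (h : IsSumModule R a m I F P S E C c t j) : SumRule P S E C c t j := by
  constructor
  · intro e z he hz
    obtain rfl := isEmpty_iff.1 he
    obtain rfl := (h.isEqClass_iff _ _).1 hz
    exact h.isAbGroup_and_isLeftUnit.2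
  · intro x hx p hp hpx r d i y hpr hdi f u w hjf hfu htw x' z z' hx' hz hz'
    obtain rfl := isOpair_iff.1 hdi
    obtain rfl := isOpair_iff.1 hpr
    obtain ⟨r', i', y', hr, hi, hy, hrd⟩ := (h.mem_iff _).1 hp
    obtain ⟨rfl, hiy⟩ := pair_inj.1 hrd
    obtain ⟨rfl, rfl⟩ := pair_inj.1 hiy
    obtain ⟨B, hj⟩ := h.isFunc
    obtain ⟨-, rfl⟩ := hj.app_iff.1 hjf
    obtain ⟨-, rfl⟩ := (h.isFunc_ap i hi).app_iff.1 hfu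
    obtain ⟨-, hju, rfl⟩ := h.isOp_smul.app₂_iff.1 htw
    obtain rfl := isInsert_iff.1 hx'
    obtain rfl := (h.isEqClass_iff _ _).1 hz
    obtain rfl := (h.isEqClass_iff _ _).1 hz'
    exact h.isOp_add.app₂_iff.2 ⟨h.isOp_smul.mem hr hju, h.cls_mem hx,
      h.cls_ins hx hr hi hy hpx⟩

end IsSumModule

/-- Only the sets `D`, `P`, `S`, `E` and `C` remain to be formed. Equality of sums is visibly an
equivalence relation, and replacement on `S` gives the set of classes. -/
theorem hasCoproduct (hR : IsCommRing R a m) (hF : IsModuleFamily R a m I F) :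
    HasCoproduct R a m I F := by
  obtain ⟨D, hD⟩ := hF.exists_isDisjointUnion
  obtain ⟨P, hP⟩ := exists_isProduct R D
  obtain ⟨S, hS⟩ := exists_isFinSubsets P
  obtain ⟨E, hE⟩ := exists_sep (cart S S) fun p => SameSum R a m I F P S (fst p) (snd p)
  have hApp (x y : M) : App E x y ↔ (Mem x S ∧ Mem y S) ∧ SameSum R a m I F P S x y := by
    simp [app_iff_mem, hE]
  have hrefl (x : M) : SameSum R a m I F P S x x := fun _ _ _ _ _ _ => rfl
  have hsymm {x y : M} (h : SameSum R a m I F P S x y) : SameSum R a m I F P S y x :=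
    fun N b s g G hG => (h N b s g G hG).symm
  have htrans {x y z : M} (h : SameSum R a m I F P S x y) (h' : SameSum R a m I F P S y z) :
      SameSum R a m I F P S x z := fun N b s g G hG => (h N b s g G hG).trans (h' N b s g G hG)
  have hequiv : IsEquivRel E S := by
    refine ⟨fun p hp => ?_, fun x hx => ?_, fun x y => ?_, fun x y z => ?_⟩
    · simpa only [isOpair_iff] using mem_cart.1 ((hE p).1 hp).1
    · exact (hApp x x).2 ⟨⟨hx, hx⟩, hrefl x⟩
    · simp only [hApp]
      exact fun h => ⟨h.1.symm, hsymm h.2⟩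
    · simp only [hApp]
      exact fun h h' => ⟨⟨h.1.1, h'.1.2⟩, htrans h.2 h'.2⟩
  have hcls (z x : M) : IsEqClass z E x ↔ z = cls E x := by
    refine exists_eq_iff_of_mem_iff ?_ z
    obtain ⟨c, hc⟩ := exists_sep S fun y => App E x y
    exact ⟨c, fun y => (hc y).trans (and_iff_right_of_imp fun h => ((hApp _ _).1 h).1.2)⟩
  obtain ⟨C, hC⟩ := exists_image S fun x => cls E x
  have hQ : IsSumQuotient R a m I F P S E C := by
    refine ⟨hR, hF, hS, fun p => ?_, hcls, fun x y hx hy => ?_, hC⟩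
    · rw [hP p]
      simp only [isOpair_iff, hF.isDisjointUnion_iff.1 hD]
      constructor
      · rintro ⟨r, hr, _, ⟨i, hi, y, hy, rfl⟩, rfl⟩
        exact ⟨r, i, y, hr, hi, hy, rfl⟩
      · rintro ⟨r, i, y, hr, hi, hy, rfl⟩
        exact ⟨r, hr, _, ⟨i, hi, y, hy, rfl⟩, rfl⟩
    · constructor
      · intro h
        -- By reflexivity `y` lies in its own class, hence in that of `x` when the classes are
        -- equal.
        have := ((hcls _ y).2 rfl y).2 ((hApp y y).2 ⟨⟨hy, hy⟩, hrefl y⟩)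
        rw [← h] at this
        exact ((hApp x y).1 (((hcls _ x).2 rfl y).1 this)).2
      · intro h
        refine mem_ext fun z => ?_
        rw [(hcls _ x).2 rfl z, (hcls _ y).2 rfl z, hApp, hApp]
        exact ⟨fun h' => ⟨⟨hy, h'.1.2⟩, htrans (hsymm h) h'.2⟩,
          fun h' => ⟨⟨hx, h'.1.2⟩, htrans h h'.2⟩⟩
  obtain ⟨c, t, j, hM⟩ := hQ.exists_isSumModule
  refine ⟨D, P, S, E, hD, hP, hS, hequiv, C, c, t, j, fun z => ?_, hM.isCoproduct, hM.sumRule⟩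
  simp only [hcls]
  exact hC z

end Coproduct
end ZFG
/-- ZFG[0] proves that every set of modules over any commutative ring has a coproduct. -/
theorem theoremT : ZFG.zfg₀ ⊨ᵇ ZFG.coproductSentence := by
  rw [FirstOrder.Language.Theory.models_sentence_iff]
  intro M
  have : ZFG.IsModel M := ⟨inferInstance, ZFG.model_zfg₀_iff.1 inferInstance⟩
  exact ZFG.realize_coproductSentence.2 fun R a m hR I F hF => ZFG.hasCoproduct hR hF
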